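/- **Setting.** Let $S^3$ carry its standard contact structure $\xi$, which is $\ker(dz-y\,dx)$ on $\mathbb R^3\subset S^3$. A *grid diagram of a knot* is an $n\times n$ grid with exactly one $X$ and one $O$ in each row and in each column, no square containing both, such that the polygon with vertical segments from the $X$'s to the $O$'s and horizontal segments from the $O$'s to the $X$'s is connected. Such a grid diagram $G$ *represents* an oriented Legendrian knot $\vec{\mathcal K}\subset S^3$ if $\vec{\mathcal K}$ is Legendrian isotopic to the Legendrian knot whose front projection is obtained from this polygon by rounding the northwest and southeast corners, turning the southwest and northeast corners into cusps, and tilting by $45^\circ$ clockwise. (Every oriented Legendrian knot is represented by some grid diagram.) Regard $G$ as a diagram on the torus, with the $O$'s numbered $O_1,\dots,O_n$, and let $\mathbf S$ be the set of bijections between the vertical and the horizontal grid circles, viewed as $n$-tuples of intersection points. For $\mathbf x,\mathbf y\in\mathbf S$ that differ in exactly two points, there are two embedded rectangles on the torus with lower left and upper right corners in $\mathbf x$ and the other two corners in $\mathbf y$; such a rectangle is *empty* if its interior contains no point of $\mathbf x$. Let $\mathcal S$ be a *sign assignment*, that is, a choice of signs $\mathcal S(r)=\pm1$ for the rectangles $r$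 (with their initial states $\mathbf x$) such that, on the free $\mathbb Z[U_1,\dots,U_n]$-module on $\mathbf S$, the endomorphism that sends $\mathbf x$ to the sum of $\mathcal S(r)\,U_1^{O_1(r)}\cdots U_n^{O_n(r)}\,\mathbf y$ over all $\mathbf y$ and all empty rectangles $r$ from $\mathbf x$ to $\mathbf y$ has square zero, and the homology of the complex obtained by setting all $U_i=1$ has nonzero rank; here $O_i(r)\in\{0,1\}$ is the multiplicity of $O_i$ in $r$. Let $\mathit{HFK}^-$ be the homology of the same module with the differential $$\partial\mathbf x=\sum_{\mathbf y\in\mathbf S}\ \sum_{r} \mathcal S(r)\,U_1^{O_1(r)}\cdots U_n^{O_n(r)}\,\mathbf y ,$$ where $r$ runs over the empty rectangles from $\mathbf x$ to $\mathbf y$ that contain no $X$. The indeterminate $U$ acts on $\mathit{HFK}^-$ as multiplication by any one of the $U_i$. Let $\mathbf x^{UR}$ and $\mathbf x^{LL}\in\mathbf S$ consist of the upper right corners, respectively the lower left corners, of the squares marked $X$; both are cycles. Put $\mathbf z^{UR}=\mathbf x^{UR}$ and $\mathbf z^{LL}=\pm\mathbf x^{LL}$, where the sign is chosen so that $[\mathbf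 z^{LL}]=U^m[\mathbf z^{UR}]$ for some $m\in\mathbb Z$ in the homology of the complex obtained by inverting all the $U_i$. The *Legendrian invariants* $\lambda^+(\vec{\mathcal K})$ and $\lambda^-(\vec{\mathcal K})$ of a Legendrian knot represented by $G$ are the classes of $\mathbf z^{UR}$ and $\mathbf z^{LL}$ in $\mathit{HFK}^-$. The *transverse invariant* $\theta(\mathcal T)$ of a transverse knot $\mathcal T$ is $\lambda^+(\vec{\mathcal K})$ for a Legendrian approximation $\vec{\mathcal K}$ to $\mathcal T$, that is, for a Legendrian knot $\vec{\mathcal K}$ in a standard contact solid torus with core $\mathcal T$ that meets each meridional disk in one point, transversally, and is oriented in the direction of $\mathcal T$. **Theorem.** For every oriented Legendrian knot $\vec{\mathcal K}$ and every grid diagram $G$ and sign assignment used to compute them, the classes $\lambda^+(\vec{\mathcal K})$ and $\lambda^-(\vec{\mathcal K})$ are nonzero, and they are not $U$-torsion: $U_i^d\,\lambda^\pm(\vec{\mathcal K})\neq0$ for all $i$ and all positive integers $d$. Likewise, for every transverse knot $\mathcal T$, every Legendrian approximation to $\mathcal T$, and every grid diagram and sign assignment used to compute it, the class $\theta(\mathcal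 T)$ is nonzero and not $U$-torsion. -/

import Mathlib

open scoped ContDiff

namespace GridLegendrian

noncomputable section

/-! ### Legendrian and transverse knots in the standard contact three-sphere -/

/-- The form `∑ (x_j dy_j - y_j dx_j)` on `ℂ × ℂ = ℝ⁴` at the point `p`, evaluated on `v`. Its kernel
on the unit sphere is the standard (cooriented) contact structure of the three-sphere. -/
def contactForm (p v : ℂ × ℂ) : ℝ :=
  (starRingEnd ℂ p.1 * v.1 + starRingEnd ℂ p.2 * v.2).im

/-- A point of the unit three-sphere in `ℂ × ℂ`. -/
def OnSphere (p : ℂ × ℂ) : Prop := Complex.normSq p.1 + Complex.normSq p.2 = 1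

/-- A smooth oriented knot in the three-sphere: a smoothly embedded circle, parametrized by `ℝ / ℤ`. -/
structure IsSmoothKnot (γ : ℝ → ℂ × ℂ) : Prop where
  smooth : ContDiff ℝ ∞ γ
  onSphere : ∀ t, OnSphere (γ t)
  periodic : ∀ t, γ (t + 1) = γ t
  immersed : ∀ t, deriv γ t ≠ 0
  embedded : ∀ s t, γ s = γ t → ∃ k : ℤ, t = s + k

/-- An oriented Legendrian knot in the three-sphere: tangent to the contact planes everywhere. -/
structure LegendrianKnot where
  toFun : ℝ → ℂ × ℂ
  isKnot : IsSmoothKnot toFun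
  tangent : ∀ t, contactForm (toFun t) (deriv toFun t) = 0

/-- A transverse knot in the three-sphere, with the orientation that it inherits from the
coorientation of the contact structure. -/
structure TransverseKnot where
  toFun : ℝ → ℂ × ℂ
  isKnot : IsSmoothKnot toFun
  transverse : ∀ t, 0 < contactForm (toFun t) (deriv toFun t)

/-- Two Legendrian knots are Legendrian isotopic: they are joined by a smooth one-parameter family
of Legendrian knots. -/
def LegendrianIsotopic (K₀ K₁ : LegendrianKnot) : Prop :=
  ∃ H : ℝ × ℝ → ℂ × ℂ, ContDiff ℝ ∞ H ∧
    (∀ s ∈ Set.Icc (0 : ℝ) 1, ∃ K : LegendrianKnot, ∀ t, K.toFun t = H (s, t)) ∧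
    (∀ t, H (0, t) = K₀.toFun t) ∧ (∀ t, H (1, t) = K₁.toFun t)

/-- A standard solid torus in the contact three-sphere: `Ψ` is a coorientation preserving
contactomorphism from `(ℝ / ℤ) × {w : ‖w‖ < R}` with the contact form `dφ + r² dθ`
(where `w = r e^{iθ}`, so `r² dθ = Im (w̄ dw)`) onto its image. It is an immersion because its
pull-back of the contact form is a positive multiple of a contact form. -/
structure IsStandardSolidTorus (R : ℝ) (Ψ : ℝ × ℂ → ℂ × ℂ) : Prop where
  pos : 0 < R
  smooth : ContDiffOn ℝ ∞ Ψ (Set.univ ×ˢ Metric.ball (0 : ℂ) R)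
  onSphere : ∀ φ w, ‖w‖ < R → OnSphere (Ψ (φ, w))
  periodic : ∀ φ w, ‖w‖ < R → Ψ (φ + 1, w) = Ψ (φ, w)
  injective : ∀ φ w φ₁ w₁, ‖w‖ < R → ‖w₁‖ < R → Ψ (φ, w) = Ψ (φ₁, w₁) →
    w = w₁ ∧ ∃ k : ℤ, φ₁ = φ + k
  contact : ∀ φ w, ‖w‖ < R → ∃ f : ℝ, 0 < f ∧ ∀ v : ℝ × ℂ,
    contactForm (Ψ (φ, w)) (fderiv ℝ Ψ (φ, w) v) = f * (v.1 + (starRingEnd ℂ w * v.2).im)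

/-- `K` is a Legendrian approximation to `T`: some standard solid torus has `T` as its core and
contains `K` as a curve that meets each meridional disk in one point, transversally, and runs in the
direction of the core. -/
def IsLegendrianApproximation (K : LegendrianKnot) (T : TransverseKnot) : Prop :=
  ∃ (R : ℝ) (Ψ : ℝ × ℂ → ℂ × ℂ) (h : ℝ → ℝ) (w : ℝ → ℂ),
    IsStandardSolidTorus R Ψ ∧ (∀ t, Ψ (t, 0) = T.toFun t) ∧
    ContDiff ℝ ∞ h ∧ ContDiff ℝ ∞ w ∧
    (∀ t, 0 < deriv h t ∧ h (t + 1) = h t + 1 ∧ w (t + 1) = w t ∧ ‖w t‖ < R) ∧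
    ∀ t, K.toFun t = Ψ (h t, w t)

/-- The embedding of `ℝ³`, with coordinates `(x, y, z)` and the contact form `dz - y dx`, in the
three-sphere as the complement of the point `(0, -1)`: the inverse Cayley transform
`(ζ, t) ↦ (2 ζ, 1 - |ζ|² + i t) / (1 + |ζ|² - i t)` at `ζ = x + i y / 4`, `t = z - x y / 2`. It pulls
the form `contactForm` back to a positive multiple of `dz - y dx`. -/
def toSphere (p : ℝ × ℝ × ℝ) : ℂ × ℂ :=
  let ζ : ℂ := ⟨p.1, p.2.1 / 4⟩
  let t : ℝ := p.2.2 - p.1 * p.2.1 / 2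
  let D : ℂ := ⟨1 + Complex.normSq ζ, -t⟩
  (2 * ζ / D, (⟨1 - Complex.normSq ζ, t⟩ : ℂ) / D)

/-! ### Grid diagrams of knots and their Legendrian knots -/

/-- An `n × n` grid diagram of a knot. Columns and rows are numbered from the left and from the
bottom; column `i` has its `O` in row `O i` and its `X` in row `X i`, and no square has both. The
permutation `X⁻¹ * O` leads from a column along the vertical segment from its `X` to its `O` and then
along the horizontal segment to the `X` in that row; as it has no fixed point, the diagram is one of
a knot exactly when this permutation is a single cycle. -/
structure KnotGrid (n : ℕ) where
  O : Equiv.Perm (Fin n)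
  X : Equiv.Perm (Fin n)
  disjoint : ∀ i, O i ≠ X i
  isCycle : (X⁻¹ * O).IsCycle

namespace KnotGrid

variable {n : ℕ}

/-- The successive corners, in the plane, of the oriented polygon of the grid diagram, which starts
at the `X` of column `c` and runs vertically from each `X` to an `O` and horizontally from each `O`
to an `X`: corner `2 m` is an `X`, corner `2 m + 1` is the `O` of the same column. -/
def corner (G : KnotGrid n) (c : Fin n) (k : ℤ) : ℝ × ℝ :=
  let i : Fin n := ((G.X⁻¹ * G.O) ^ (k / 2)) c
  ((i : ℕ) + 1 / 2, (((if Even k then G.X i else G.O i) : Fin n) : ℕ) + 1 / 2)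

/-- The unit vector along the edge from corner `k` to corner `k + 1`. -/
def edgeDir (G : KnotGrid n) (c : Fin n) (k : ℤ) : ℝ × ℝ :=
  (Real.sign ((G.corner c (k + 1)).1 - (G.corner c k).1),
    Real.sign ((G.corner c (k + 1)).2 - (G.corner c k).2))

/-- Corner `k` is a northeast or a southwest corner, one that becomes a cusp: the displacements to
the neighbouring corner in its row and to the one in its column have the same sign. -/
def IsCuspCorner (G : KnotGrid n) (c : Fin n) (k : ℤ) : Prop :=
  0 < ((G.corner c (k - 1)).1 + (G.corner c (k + 1)).1 - 2 * (G.corner c k).1) *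
      ((G.corner c (k - 1)).2 + (G.corner c (k + 1)).2 - 2 * (G.corner c k).2)

/-- The point of the plane of the grid that is over the point `(x, y, z)`: the front projection
`(x, z)`, turned back. The plane of the grid is tilted by 45 degrees clockwise (and
stretched by the factor `√2`) by `(p, q) ↦ (x, z) = (p + q, q - p)`, so that northeast
becomes right and northwest becomes up. -/
def frontPoint (P : ℝ × ℝ × ℝ) : ℝ × ℝ := ((P.1 - P.2.2) / 2, (P.1 + P.2.2) / 2)

/-- The curve `g` in `ℝ³` is Legendrian, and its front projection is the tilted grid diagram with
northwest and southeast corners rounded and with northeast and southwest corners turned into cusps.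
The time `s / (2 n)` lies on an edge for `s ∈ [k + 1/4, k + 3/4]` and near corner `k` for
`s ∈ [k - 1/4, k + 1/4]`, where the front differs from the polygon only in the square
of side `1/2` about the corner. -/
structure IsFrontOf (G : KnotGrid n) (c : Fin n) (g : ℝ → ℝ × ℝ × ℝ) : Prop where
  smooth : ContDiff ℝ ∞ g
  periodic : ∀ t, g (t + 1) = g t
  legendrian : ∀ t, (deriv g t).2.2 = (g t).2.1 * (deriv g t).1
  edge : ∀ k : ℤ, ∀ u ∈ Set.Icc (0 : ℝ) 1,
    frontPoint (g ((k + 1 / 4 + u / 2) / (2 * n))) =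
      (1 - u) • (G.corner c k + (1 / 4 : ℝ) • G.edgeDir c k) +
        u • (G.corner c (k + 1) - (1 / 4 : ℝ) • G.edgeDir c k)
  near : ∀ k : ℤ, ∀ s ∈ Set.Icc (k - 1 / 4 : ℝ) (k + 1 / 4),
    |(frontPoint (g (s / (2 * n)))).1 - (G.corner c k).1| ≤ 1 / 4 ∧
    |(frontPoint (g (s / (2 * n)))).2 - (G.corner c k).2| ≤ 1 / 4
  simple : ∀ k : ℤ, Set.InjOn (fun s : ℝ => frontPoint (g (s / (2 * n))))
    (Set.Icc (k - 1 / 4 : ℝ) (k + 1 / 4))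
  cusp : ∀ k : ℤ, G.IsCuspCorner c k →
    ∃! s : ℝ, s ∈ Set.Icc (k - 1 / 4 : ℝ) (k + 1 / 4) ∧ (deriv g (s / (2 * n))).1 = 0
  rounded : ∀ k : ℤ, ¬ G.IsCuspCorner c k →
    ∀ s ∈ Set.Icc (k - 1 / 4 : ℝ) (k + 1 / 4), (deriv g (s / (2 * n))).1 ≠ 0

/-- The grid diagram `G` represents the oriented Legendrian knot `K`: up to Legendrian isotopy, `K`
is the Legendrian knot whose front projection is obtained from `G`. -/
def Represents (G : KnotGrid n) (K : LegendrianKnot) : Prop :=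
  ∃ (c : Fin n) (g : ℝ → ℝ × ℝ × ℝ) (L : LegendrianKnot),
    G.IsFrontOf c g ∧ (∀ t, L.toFun t = toSphere (g t)) ∧ LegendrianIsotopic K L

end KnotGrid

/-! ### The combinatorial chain complex of a grid diagram on the torus -/

/-- One-to-one correspondences between vertical and horizontal grid circles. The vertical circle `i`
is the left edge of column `i`, the horizontal circle `j` is the bottom edge of row `j`. -/
abbrev GridState (n : ℕ) : Type := Equiv.Perm (Fin n)

/-- The cyclic interval from the circle `a` to the circle `b` (going right, or up) contains the
column (or row) `c`, that is, the strip between the circles `c` and `c + 1`. -/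
def InStrip {n : ℕ} (a b c : Fin n) : Prop := ((c - a : Fin n) : ℕ) < ((b - a : Fin n) : ℕ)

/-- The circle `c` lies strictly between the circles `a` and `b` in the cyclic order. -/
def StrictlyBetween {n : ℕ} (a b c : Fin n) : Prop := c ≠ a ∧ InStrip a b c

/-- The rectangles on the torus that start at a state `x`: such a rectangle is given by the
vertical circles `a` and `b` that bound it on the left and on the right. Its lower left corner is
the point `(a, x a)` of `x` and its upper right corner is the point `(b, x b)` of `x`, and the other
two corners belong to the state `x * swap a b` to which it leads. -/
abbrev Rect (n : ℕ) : Type := {p : Fin n × Fin n // p.1 ≠ p.2}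

namespace Rect

variable {n : ℕ}

/-- The state to which the rectangle from `x` leads. -/
def target (r : Rect n) (x : GridState n) : GridState n := x * Equiv.swap r.1.1 r.1.2

/-- The rectangle from `x` contains the square in column `i` and row `j`. -/
def HasSquare (r : Rect n) (x : GridState n) (i j : Fin n) : Prop :=
  InStrip r.1.1 r.1.2 i ∧ InStrip (x r.1.1) (x r.1.2) j

/-- The interior of the rectangle contains no point of `x`. -/
def IsEmptyRect (r : Rect n) (x : GridState n) : Prop :=
  ∀ i, ¬ (StrictlyBetween r.1.1 r.1.2 i ∧ StrictlyBetween (x r.1.1) (x r.1.2) (x i))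

end Rect

/-- A choice of sign for each rectangle (with its initial state). -/
abbrev RectSign (n : ℕ) : Type := GridState n → Rect n → ℤˣ

/-- The homology `ker d / im d` of a module with a differential `d` (with `d ∘ d = 0`). -/
abbrev Homology {R M : Type} [CommRing R] [AddCommGroup M] [Module R M] (d : M →ₗ[R] M) : Type :=
  LinearMap.ker d ⧸ (LinearMap.range d).comap (LinearMap.ker d).subtype

namespace KnotGrid

variable {n : ℕ}

open Classical in
/-- The endomorphism of the free `R`-module on the states that sends `x` to the sum of
`S(r) u₁^{O₁(r)} ⋯ u_n^{O_n(r)} y` over all states `y` and all empty rectangles `r` from `x` to `y`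
with the property `allowed`. Here `O_i` is the `O` in column `i`. -/
def gridMap (G : KnotGrid n) (S : RectSign n) (allowed : GridState n → Rect n → Prop)
    {R : Type} [CommRing R] (u : Fin n → R) : (GridState n →₀ R) →ₗ[R] (GridState n →₀ R) :=
  Finsupp.linearCombination R fun x =>
    ∑ r : Rect n, if r.IsEmptyRect x ∧ allowed x r then
      Finsupp.single (r.target x)
        (((S x r : ℤ) : R) * ∏ i, if r.HasSquare x i (G.O i) then u i else 1)
    else 0

/-- The rectangle from `x` contains no `X`. -/
def NoX (G : KnotGrid n) (x : GridState n) (r : Rect n) : Prop := ∀ i, ¬ r.HasSquare x i (G.X i)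

/-- The endomorphism of the filtered module: all empty rectangles are counted. -/
def filteredMap (G : KnotGrid n) (S : RectSign n) {R : Type} [CommRing R] (u : Fin n → R) :
    (GridState n →₀ R) →ₗ[R] (GridState n →₀ R) :=
  G.gridMap S (fun _ _ => True) u

/-- The differential of the associated graded module: empty rectangles without `X` are counted. -/
def gradedMap (G : KnotGrid n) (S : RectSign n) {R : Type} [CommRing R] (u : Fin n → R) :
    (GridState n →₀ R) →ₗ[R] (GridState n →₀ R) :=
  G.gridMap S G.NoX u

/-- `S` is a sign assignment: it makes the endomorphism of the filtered module over
`ℤ[U₁, …, U_n]` a differential, and the homology of the resulting complex with all `U_i` set to `1`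
has nonzero rank. -/
structure IsSignAssignment (G : KnotGrid n) (S : RectSign n) : Prop where
  differential : G.filteredMap S (MvPolynomial.X (R := ℤ)) ∘ₗ
    G.filteredMap S (MvPolynomial.X (R := ℤ)) = 0
  rank : Nontrivial (TensorProduct ℤ ℚ (Homology (G.filteredMap S (fun _ => (1 : ℤ)))))

/-- The state that consists of the lower left corners of the squares with an `X`. -/
def xLL (G : KnotGrid n) : GridState n := G.X

/-- The state that consists of the upper right corners of the squares with an `X`: if `(i, j)` is
such a square, it contains the point `(i + 1, j + 1)`, cyclically. -/
def xUR (G : KnotGrid n) : GridState n := finRotate n * G.X * (finRotate n)⁻¹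

theorem gridMap_single_eq_zero (G : KnotGrid n) (S : RectSign n)
    (allowed : GridState n → Rect n → Prop) {R : Type} [CommRing R] (u : Fin n → R)
    (x : GridState n) (hx : ∀ r, ¬ allowed x r) :
    G.gridMap S allowed u (Finsupp.single x 1) = 0 := by
  simp [gridMap, Finsupp.linearCombination_single, hx]

theorem inStrip_self {a b : Fin n} (h : a ≠ b) : InStrip a b a := by
  obtain _ | m := n
  · exact a.elim0
  · rw [InStrip, sub_self, Fin.val_zero]
    exact Nat.pos_of_ne_zero fun h0 => h (sub_eq_zero.mp (Fin.ext h0)).symm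

theorem inStrip_finRotate {a c : Fin n} (h : a ≠ finRotate n c) :
    InStrip a (finRotate n c) c := by
  obtain _ | m := n
  · exact a.elim0
  · rw [finRotate_apply] at h ⊢
    have h1 : c + 1 - a = (c - a) + 1 := by abel
    rw [InStrip, h1, Fin.val_add_one]
    split_ifs with h2
    · exact absurd (sub_eq_zero.mp (by rw [h1, h2, Fin.last_add_one])).symm h
    · exact Nat.lt_succ_self _

theorem gradedMap_xLL (G : KnotGrid n) (S : RectSign n) {R : Type} [CommRing R] (u : Fin n → R) :
    G.gradedMap S u (Finsupp.single G.xLL 1) = 0 :=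
  G.gridMap_single_eq_zero S _ u _ fun r hr => hr r.1.1
    ⟨inStrip_self r.2, inStrip_self fun h => r.2 (G.X.injective h)⟩

theorem gradedMap_xUR (G : KnotGrid n) (S : RectSign n) {R : Type} [CommRing R] (u : Fin n → R) :
    G.gradedMap S u (Finsupp.single G.xUR 1) = 0 :=
  G.gridMap_single_eq_zero S _ u _ fun r hr => by
    obtain ⟨⟨a, b⟩, hab⟩ := r
    obtain ⟨c, rfl⟩ := (finRotate n).surjective b
    have h2 : G.xUR (finRotate n c) = finRotate n (G.X c) := by
      simp only [xUR, Equiv.Perm.mul_apply, Equiv.Perm.inv_def, Equiv.symm_apply_apply]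
    refine hr c ⟨inStrip_finRotate hab, ?_⟩
    change InStrip (G.xUR a) (G.xUR (finRotate n c)) (G.X c)
    have h3 : G.xUR a ≠ G.xUR (finRotate n c) := fun h => hab (G.xUR.injective h)
    rw [h2] at h3 ⊢
    exact inStrip_finRotate h3

/-- The state `xLL` as a cycle. -/
def cycleLL (G : KnotGrid n) (S : RectSign n) {R : Type} [CommRing R] (u : Fin n → R) :
    LinearMap.ker (G.gradedMap S u) :=
  ⟨Finsupp.single G.xLL 1, G.gradedMap_xLL S u⟩

/-- The state `xUR` as a cycle. -/
def cycleUR (G : KnotGrid n) (S : RectSign n) {R : Type} [CommRing R] (u : Fin n → R) :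
    LinearMap.ker (G.gradedMap S u) :=
  ⟨Finsupp.single G.xUR 1, G.gradedMap_xUR S u⟩

/-- Knot Floer homology `HFK⁻`, computed from the grid diagram: the homology of the complex over
`ℤ[U₁, …, U_n]` that is generated by the states, with the differential `gradedMap`. The
indeterminate `U` of `ℤ[U]` acts on it as multiplication by any of the `U_i`. -/
abbrev HFKMinus (G : KnotGrid n) (S : RectSign n) : Type :=
  Homology (G.gradedMap S (MvPolynomial.X (R := ℤ)))

/-- A class is `U`-torsion if some power of `U`, of positive exponent, annihilates it. -/
def IsUTorsion (G : KnotGrid n) (S : RectSign n) (η : G.HFKMinus S) : Prop :=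
  ∃ (i : Fin n) (d : ℕ), 0 < d ∧ (MvPolynomial.X i : MvPolynomial (Fin n) ℤ) ^ d • η = 0

/-- The ring of Laurent polynomials `ℤ[U₁, U₁⁻¹, …, U_n, U_n⁻¹]`. -/
abbrev Laurent (n : ℕ) : Type := AddMonoidAlgebra ℤ (Fin n →₀ ℤ)

/-- The Laurent monomial `U_i ^ m`. -/
def laurentPow (i : Fin n) (m : ℤ) : Laurent n :=
  AddMonoidAlgebra.single (Finsupp.single i m) 1

/-- The homology of the complex over the Laurent polynomials obtained by inverting all `U_i`. -/
abbrev HShriek (G : KnotGrid n) (S : RectSign n) : Type :=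
  Homology (G.gradedMap S (fun i : Fin n => laurentPow i 1))

open Classical in
/-- The sign of the cycle `zLL`: it is chosen so that in the homology of the complex over the
Laurent polynomials the class of `zLL` is a power of `U` (with an integer exponent) times that
of `xUR`. -/
def signLL (G : KnotGrid n) (S : RectSign n) : ℤˣ :=
  if ∃ m : ℤ, ∀ i : Fin n,
    (Submodule.Quotient.mk (G.cycleLL S (fun i : Fin n => laurentPow i 1)) : G.HShriek S) =
      laurentPow i m •
        (Submodule.Quotient.mk (G.cycleUR S (fun i : Fin n => laurentPow i 1)) : G.HShriek S)
  then 1 else -1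

/-- The class of `zUR = xUR`. -/
def lambdaPlus (G : KnotGrid n) (S : RectSign n) : G.HFKMinus S :=
  Submodule.Quotient.mk (G.cycleUR S MvPolynomial.X)

/-- The class of `zLL = ± xLL`. -/
def lambdaMinus (G : KnotGrid n) (S : RectSign n) : G.HFKMinus S :=
  Submodule.Quotient.mk ((G.signLL S : ℤ) • G.cycleLL S MvPolynomial.X)

/-- The transverse invariant, computed from a grid diagram of a Legendrian approximation. -/
def theta (G : KnotGrid n) (S : RectSign n) : G.HFKMinus S := G.lambdaPlus S

end KnotGrid

end

end GridLegendrian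

/-! Reduce modulo 2 and set every `U_i` equal to 1. A function `φ` on states that is a cocycle for
the count of empty rectangles without an `X` extends to a functional that kills all boundaries and
sees neither signs nor powers of the `U_i`. If `φ` is 1 on a state that is a cycle, then no `U_i ^
d` annihilates its class (`smul_mk_ne_zero`). So it suffices to find such a `φ` for `xUR` and for
`xLL`.

The construction starts from the indicator of the state of upper left corners of the `X`-squares, a
cocycle because every rectangle into that state contains an `X` (`dualMap_single_upperLeft`). Let
`H_k` be dual to the count of empty rectangles whose only `X` is that of column `k`. It commutes
with the coboundary modulo 2 (`dualMap_comm`): composites are paired by recutting the union of two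
rectangles, and the vertical annulus of column `k` cancels the horizontal annulus through the same
`X` (`flip_spec`), which works because the `U_i` are 1.

With `n = m + 1` and columns numbered from 0, applying `H_m, …, H_1` in turn therefore gives a
cocycle. Its value on `xUR` is the number modulo 2 of chains of empty rectangles from `xUR` to the
upper left state that pick up the `X`'s of columns `1, …, m` one at a time, in this order.
Rectangles of width one form such a chain. It is the only one: nonnegativity and the prescribed
multiplicities at the `X`'s confine the domain of any chain (`IsDomain.eq_zero`), which determines
each rectangle (`eq_of_isEmptyWith_leftPath`). Rotating the torus by 180 degrees carries the result
over to `xLL`. -/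

namespace GridLegendrian

noncomputable section

/-! ### Cyclic intervals -/

section Cyclic

variable {n : ℕ}

theorem val_sub_eq (a b : Fin n) :
    ((a - b : Fin n) : ℕ) = if (b : ℕ) ≤ a then (a : ℕ) - b else n + a - b := by
  split_ifs with h
  · exact Fin.coe_sub_iff_le.2 h
  · exact Fin.coe_sub_iff_lt.2 (not_le.1 h)

theorem inStrip_iff {a b c : Fin n} : InStrip a b c ↔
    ((a : ℕ) ≤ c ∧ (c : ℕ) < b) ∨ ((b : ℕ) < a ∧ ((a : ℕ) ≤ c ∨ (c : ℕ) < b)) := by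
  have := a.2; have := b.2; have := c.2
  simp only [InStrip, val_sub_eq]
  split_ifs <;> omega

theorem strictlyBetween_iff {a b c : Fin n} : StrictlyBetween a b c ↔
    ((a : ℕ) < c ∧ (c : ℕ) < b) ∨ ((b : ℕ) < a ∧ ((a : ℕ) < c ∨ (c : ℕ) < b)) := by
  simp only [StrictlyBetween, inStrip_iff, ne_eq, Fin.ext_iff]
  omega

theorem StrictlyBetween.rotate {a b c : Fin n} (h : StrictlyBetween a b c) :
    StrictlyBetween c a b := by
  rw [strictlyBetween_iff] at *; omega

theorem not_strictlyBetween_left {a b : Fin n} : ¬ StrictlyBetween a b a := fun h => h.1 rfl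

theorem not_strictlyBetween_right {a b : Fin n} : ¬ StrictlyBetween a b b := by
  rw [strictlyBetween_iff]; omega

theorem not_strictlyBetween_self {a b : Fin n} : ¬ StrictlyBetween a a b := by
  rw [strictlyBetween_iff]; omega

theorem StrictlyBetween.asymm {a b c : Fin n} (h : StrictlyBetween a b c) :
    ¬ StrictlyBetween a c b := by
  rw [strictlyBetween_iff] at *; omega

/-- The cyclic order is total. -/
theorem strictlyBetween_or {a b c : Fin n} (hab : a ≠ b) (hac : a ≠ c) (hbc : b ≠ c) :
    StrictlyBetween a b c ∨ StrictlyBetween a c b := by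
  rw [strictlyBetween_iff, strictlyBetween_iff]
  rw [ne_eq, Fin.ext_iff] at *; omega

theorem StrictlyBetween.split {a b c : Fin n} (h : StrictlyBetween a b c) (v : Fin n) :
    StrictlyBetween a b v ↔ StrictlyBetween a c v ∨ v = c ∨ StrictlyBetween c b v := by
  simp only [strictlyBetween_iff, Fin.ext_iff] at *; omega

/-- An arc that starts inside another one and ends outside must pass the right end of the latter. -/
theorem StrictlyBetween.of_left {a b c d : Fin n} (h : StrictlyBetween c d a)
    (hb : ¬ StrictlyBetween c d b) (hbd : b ≠ d) : StrictlyBetween a b d := by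
  simp only [strictlyBetween_iff, ne_eq, Fin.ext_iff] at *; omega

theorem StrictlyBetween.of_right {a b c d : Fin n} (h : StrictlyBetween c d b)
    (ha : ¬ StrictlyBetween c d a) (hac : a ≠ c) : StrictlyBetween a b c := by
  simp only [strictlyBetween_iff, ne_eq, Fin.ext_iff] at *; omega

open Classical in
/-- The indicator function of a cyclic interval. -/
def strip (a b c : Fin n) : ℤ := if InStrip a b c then 1 else 0

theorem strip_of {a b c : Fin n} (h : InStrip a b c) : strip a b c = 1 := if_pos h

theorem strip_of_not {a b c : Fin n} (h : ¬ InStrip a b c) : strip a b c = 0 := if_neg h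

theorem strip_nonneg (a b c : Fin n) : 0 ≤ strip a b c := by
  unfold strip; split_ifs <;> simp

theorem StrictlyBetween.strip_add {a b c : Fin n} (h : StrictlyBetween a b c) (v : Fin n) :
    strip a b v = strip a c v + strip c b v := by
  simp only [strip, strictlyBetween_iff, inStrip_iff] at *
  split_ifs <;> omega

theorem strip_add_swap {a b : Fin n} (h : a ≠ b) (v : Fin n) :
    strip a b v + strip b a v = 1 := by
  rw [ne_eq, Fin.ext_iff] at h
  simp only [strip, inStrip_iff]
  split_ifs <;> omega

end Cyclic

/-! ### Pairs of empty rectangles -/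

section Pairs

variable {n : ℕ}

/-- The rectangle from `x` between the vertical circles `a` and `b` is empty. -/
def Emp (x : GridState n) (a b : Fin n) : Prop :=
  ∀ i, ¬ (StrictlyBetween a b i ∧ StrictlyBetween (x a) (x b) (x i))

/-- The multiplicity of a square in the rectangle from `x` between the vertical circles
`a` and `b`. -/
def mult (x : GridState n) (a b i j : Fin n) : ℤ := strip a b i * strip (x a) (x b) j

/-- `(a, b)` and `(c, d)` bound successive empty rectangles from `x`, with total multiplicity `1` at
the marking of column `k` and multiplicity `0` at the other markings. -/
structure IsPair (X x : GridState n) (k a b c d : Fin n) : Prop where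
  ne₁ : a ≠ b
  ne₂ : c ≠ d
  emp₁ : Emp x a b
  emp₂ : Emp (x * Equiv.swap a b) c d
  mult : ∀ i, mult x a b i (X i) + mult (x * Equiv.swap a b) c d i (X i) = if i = k then 1 else 0

theorem mul_swap_of_ne (x : GridState n) {a b c : Fin n} (ha : c ≠ a) (hb : c ≠ b) :
    (x * Equiv.swap a b) c = x c := by simp [Equiv.swap_apply_of_ne_of_ne ha hb]

theorem mul_swap_left (x : GridState n) (a b : Fin n) :
    (x * Equiv.swap a b) a = x b := by simp

theorem mul_swap_right (x : GridState n) (a b : Fin n) :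
    (x * Equiv.swap a b) b = x a := by simp

variable {X x : GridState n} {k a b c d : Fin n}

/-- Emptiness survives the exchange because a corner of one rectangle inside the other would, given
that the remaining corners stay out, force a corner of the latter into the former. -/
theorem IsPair.swap_of_disjoint (h : IsPair X x k a b c d) (hca : c ≠ a) (hcb : c ≠ b)
    (hda : d ≠ a) (hdb : d ≠ b) : IsPair X x k c d a b := by
  obtain ⟨h1, h2, h3, h4, h5⟩ := h
  simp only [Emp, mul_swap_of_ne x hca hcb, mul_swap_of_ne x hda hdb] at h3 h4
  have e1 := h3 c
  have e2 := h3 d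
  have e3 := h4 a
  have e4 := h4 b
  rw [mul_swap_left] at e3
  rw [mul_swap_right] at e4
  refine ⟨h2, h1, fun i hi => ?_, fun i hi => ?_, fun i => ?_⟩
  · by_cases ia : i = a
    · subst ia
      exact e2 ⟨hi.1.of_left (fun h => e4 ⟨h, hi.2⟩) hdb.symm,
        hi.2.of_left (fun h => e3 ⟨hi.1, h⟩) (x.injective.ne hdb.symm)⟩
    by_cases ib : i = b
    · subst ib
      exact e1 ⟨hi.1.of_right (fun h => e3 ⟨h, hi.2⟩) hca.symm,
        hi.2.of_right (fun h => e4 ⟨hi.1, h⟩) (x.injective.ne hca.symm)⟩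
    exact h4 i (by rwa [mul_swap_of_ne x ia ib])
  · rw [mul_swap_of_ne x hca.symm hda.symm, mul_swap_of_ne x hcb.symm hdb.symm] at hi
    by_cases ic : i = c
    · subst ic
      rw [mul_swap_left] at hi
      exact e4 ⟨hi.1.of_left (fun h => e2 ⟨h, hi.2⟩) hdb,
        hi.2.of_right (fun h => e1 ⟨hi.1, h⟩) (x.injective.ne hca)⟩
    by_cases id : i = d
    · subst id
      rw [mul_swap_right] at hi
      exact e3 ⟨hi.1.of_right (fun h => e1 ⟨h, hi.2⟩) hca,
        hi.2.of_left (fun h => e2 ⟨hi.1, h⟩) (x.injective.ne hdb)⟩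
    exact h3 i (by rwa [mul_swap_of_ne x ic id] at hi)
  · have := h5 i
    simp only [GridLegendrian.mult, mul_swap_of_ne x hca hcb, mul_swap_of_ne x hda hdb,
      mul_swap_of_ne x hca.symm hda.symm, mul_swap_of_ne x hcb.symm hdb.symm] at this ⊢
    rw [add_comm]; exact this

/-- An L-shaped region, cut along either side of its reflex corner. -/
theorem IsPair.cut_lower_left (h : IsPair X x k a b a c) (h0 : StrictlyBetween a b c) :
    IsPair X x k a c c b ∧ StrictlyBetween (x a) (x c) (x b) := by
  obtain ⟨h1, h2, h3, h4, h5⟩ := h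
  have h6 : c ≠ b := fun h => not_strictlyBetween_right (h ▸ h0)
  -- The other cyclic order would put the point of `x` on circle `c` inside the first rectangle.
  have h7 : StrictlyBetween (x a) (x c) (x b) :=
    (strictlyBetween_or (x.injective.ne h1) (x.injective.ne h2)
      (x.injective.ne h6.symm)).resolve_left fun h => h3 c ⟨h0, h⟩
  have s1 := StrictlyBetween.split h0
  have s2 := StrictlyBetween.split h7
  simp only [Emp, GridLegendrian.mult, mul_swap_left, mul_swap_of_ne x h2.symm h6] at h3 h4 h5
  refine ⟨⟨h2, h6, fun i hi => ?_, fun i hi => ?_, fun i => ?_⟩, h7⟩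
  · have e1 := h3 i
    have e2 := h4 i
    grind [mul_swap_left, mul_swap_right, mul_swap_of_ne, not_strictlyBetween_left,
      not_strictlyBetween_right, Equiv.apply_eq_iff_eq]
  · have e1 := h3 i
    have e2 := h4 i
    grind [mul_swap_left, mul_swap_right, mul_swap_of_ne, not_strictlyBetween_left,
      not_strictlyBetween_right, Equiv.apply_eq_iff_eq]
  · rw [← h5, GridLegendrian.mult, GridLegendrian.mult, mul_swap_right,
      mul_swap_of_ne x h1.symm h6.symm,
      h0.strip_add, h7.strip_add]
    ring

/-- The inverse recutting: now the order of the rows is given and emptiness forces that of the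
columns. With the forward move this makes `flip` an involution. -/
theorem IsPair.cut_lower_left_symm (h : IsPair X x k a c c b)
    (h0 : StrictlyBetween (x a) (x c) (x b)) :
    IsPair X x k a b a c ∧ StrictlyBetween a b c := by
  obtain ⟨h1, h2, h3, h4, h5⟩ := h
  have h6 : a ≠ b := fun h => not_strictlyBetween_left (h ▸ h0)
  have h7 : StrictlyBetween a b c :=
    (strictlyBetween_or h6 h1 h2.symm).resolve_right fun h => h3 b ⟨h, h0⟩
  have s1 := StrictlyBetween.split h7
  have s2 := StrictlyBetween.split h0
  simp only [Emp, GridLegendrian.mult, mul_swap_right, mul_swap_of_ne x h6.symm h2.symm] at h3 h4 h5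
  refine ⟨⟨h6, h1, fun i hi => ?_, fun i hi => ?_, fun i => ?_⟩, h7⟩
  · have e1 := h3 i
    have e2 := h4 i
    grind [mul_swap_left, mul_swap_right, mul_swap_of_ne, not_strictlyBetween_left,
      not_strictlyBetween_right, Equiv.apply_eq_iff_eq]
  · have e1 := h3 i
    have e2 := h4 i
    grind [mul_swap_left, mul_swap_right, mul_swap_of_ne, not_strictlyBetween_left,
      not_strictlyBetween_right, Equiv.apply_eq_iff_eq]
  · rw [← h5, GridLegendrian.mult, GridLegendrian.mult, mul_swap_left, mul_swap_of_ne x h1.symm h2,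
      h7.strip_add, h0.strip_add]
    ring

/-- An L-shaped region, cut along either side of its reflex corner. -/
theorem IsPair.cut_upper_left (h : IsPair X x k a b a c) (h0 : StrictlyBetween a c b) :
    IsPair X x k b c a b ∧ StrictlyBetween (x a) (x c) (x b) := by
  obtain ⟨h1, h2, h3, h4, h5⟩ := h
  have h6 : b ≠ c := fun h => not_strictlyBetween_right (h ▸ h0)
  have h7 : StrictlyBetween (x a) (x c) (x b) :=
    (strictlyBetween_or (x.injective.ne h1) (x.injective.ne h2)
      (x.injective.ne h6)).resolve_left fun h => h4 b ⟨h0, by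
      rw [mul_swap_left, mul_swap_right, mul_swap_of_ne x h2.symm h6.symm]
      exact h.rotate.rotate⟩
  have s1 := StrictlyBetween.split h0
  have s2 := StrictlyBetween.split h7
  simp only [Emp, GridLegendrian.mult, mul_swap_left, mul_swap_of_ne x h2.symm h6.symm] at h3 h4 h5
  refine ⟨⟨h6, h1, fun i hi => ?_, fun i hi => ?_, fun i => ?_⟩, h7⟩
  · have e1 := h3 i
    have e2 := h4 i
    grind [mul_swap_left, mul_swap_right, mul_swap_of_ne, not_strictlyBetween_left,
      not_strictlyBetween_right, Equiv.apply_eq_iff_eq]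
  · have e1 := h3 i
    have e2 := h4 i
    grind [mul_swap_left, mul_swap_right, mul_swap_of_ne, not_strictlyBetween_left,
      not_strictlyBetween_right, Equiv.apply_eq_iff_eq]
  · rw [← h5, GridLegendrian.mult, GridLegendrian.mult, mul_swap_left, mul_swap_of_ne x h1 h2,
      h0.strip_add, h7.strip_add]
    ring

theorem IsPair.cut_upper_left_symm (h : IsPair X x k b c a b)
    (h0 : StrictlyBetween (x a) (x c) (x b)) :
    IsPair X x k a b a c ∧ StrictlyBetween a c b := by
  obtain ⟨h1, h2, h3, h4, h5⟩ := h
  have h6 : a ≠ c := fun h => not_strictlyBetween_self (h ▸ h0)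
  have h7 : StrictlyBetween a c b :=
    (strictlyBetween_or h2 h6 h1).resolve_left fun h => h4 c ⟨h, by
      rwa [mul_swap_left, mul_swap_right, mul_swap_of_ne x h2 h6]⟩
  have s1 := StrictlyBetween.split h7
  have s2 := StrictlyBetween.split h0
  simp only [Emp, GridLegendrian.mult, mul_swap_left, mul_swap_of_ne x h2 h6] at h3 h4 h5
  refine ⟨⟨h2, h6, fun i hi => ?_, fun i hi => ?_, fun i => ?_⟩, h7⟩
  · have e1 := h3 i
    have e2 := h4 i
    grind [mul_swap_left, mul_swap_right, mul_swap_of_ne, not_strictlyBetween_left,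
      not_strictlyBetween_right, Equiv.apply_eq_iff_eq]
  · have e1 := h3 i
    have e2 := h4 i
    grind [mul_swap_left, mul_swap_right, mul_swap_of_ne, not_strictlyBetween_left,
      not_strictlyBetween_right, Equiv.apply_eq_iff_eq]
  · rw [← h5, GridLegendrian.mult, GridLegendrian.mult, mul_swap_left,
      mul_swap_of_ne x h6.symm h1.symm,
      h7.strip_add, h0.strip_add]
    ring

/-- An L-shaped region, cut along either side of its reflex corner. -/
theorem IsPair.cut_lower_right (h : IsPair X x k a b c b) (h0 : StrictlyBetween a b c) :
    IsPair X x k c b a c ∧ StrictlyBetween (x c) (x b) (x a) := by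
  obtain ⟨h1, h2, h3, h4, h5⟩ := h
  have h6 : a ≠ c := fun h => not_strictlyBetween_left (h ▸ h0)
  have h7 : StrictlyBetween (x c) (x b) (x a) :=
    (strictlyBetween_or (x.injective.ne h6.symm) (x.injective.ne h2)
      (x.injective.ne h1)).resolve_left fun h => h3 c ⟨h0, h.rotate.rotate⟩
  have s1 := StrictlyBetween.split h0
  have s2 := StrictlyBetween.split h7
  simp only [Emp, GridLegendrian.mult, mul_swap_right, mul_swap_of_ne x h6.symm h2] at h3 h4 h5
  refine ⟨⟨h2, h6, fun i hi => ?_, fun i hi => ?_, fun i => ?_⟩, h7⟩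
  · have e1 := h3 i
    have e2 := h4 i
    grind [mul_swap_left, mul_swap_right, mul_swap_of_ne, not_strictlyBetween_left,
      not_strictlyBetween_right, Equiv.apply_eq_iff_eq]
  · have e1 := h3 i
    have e2 := h4 i
    grind [mul_swap_left, mul_swap_right, mul_swap_of_ne, not_strictlyBetween_left,
      not_strictlyBetween_right, Equiv.apply_eq_iff_eq]
  · rw [← h5, GridLegendrian.mult, GridLegendrian.mult, mul_swap_left, mul_swap_of_ne x h6 h1,
      h0.strip_add, h7.strip_add]
    ring

theorem IsPair.cut_lower_right_symm (h : IsPair X x k c b a c)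
    (h0 : StrictlyBetween (x c) (x b) (x a)) :
    IsPair X x k a b c b ∧ StrictlyBetween a b c := by
  obtain ⟨h1, h2, h3, h4, h5⟩ := h
  have h6 : a ≠ b := fun h => not_strictlyBetween_right (h ▸ h0)
  have h7 : StrictlyBetween a b c :=
    (strictlyBetween_or h6 h2 h1.symm).resolve_right fun h => h3 a ⟨h.rotate.rotate, h0⟩
  have s1 := StrictlyBetween.split h7
  have s2 := StrictlyBetween.split h0
  simp only [Emp, GridLegendrian.mult, mul_swap_left, mul_swap_of_ne x h2 h6] at h3 h4 h5
  refine ⟨⟨h6, h1, fun i hi => ?_, fun i hi => ?_, fun i => ?_⟩, h7⟩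
  · have e1 := h3 i
    have e2 := h4 i
    grind [mul_swap_left, mul_swap_right, mul_swap_of_ne, not_strictlyBetween_left,
      not_strictlyBetween_right, Equiv.apply_eq_iff_eq]
  · have e1 := h3 i
    have e2 := h4 i
    grind [mul_swap_left, mul_swap_right, mul_swap_of_ne, not_strictlyBetween_left,
      not_strictlyBetween_right, Equiv.apply_eq_iff_eq]
  · rw [← h5, GridLegendrian.mult, GridLegendrian.mult, mul_swap_right, mul_swap_of_ne x h2.symm h1,
      h7.strip_add, h0.strip_add]
    ring

/-- An L-shaped region, cut along either side of its reflex corner. -/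
theorem IsPair.cut_upper_right (h : IsPair X x k a b c b) (h0 : StrictlyBetween c b a) :
    IsPair X x k c a a b ∧ StrictlyBetween (x c) (x b) (x a) := by
  obtain ⟨h1, h2, h3, h4, h5⟩ := h
  have h6 : c ≠ a := fun h => not_strictlyBetween_left (h ▸ h0)
  have h7 : StrictlyBetween (x c) (x b) (x a) :=
    (strictlyBetween_or (x.injective.ne h6) (x.injective.ne h2)
      (x.injective.ne h1)).resolve_left fun h => h4 a ⟨h0, by
      rwa [mul_swap_left, mul_swap_right, mul_swap_of_ne x h6 h2]⟩
  have s1 := StrictlyBetween.split h0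
  have s2 := StrictlyBetween.split h7
  simp only [Emp, GridLegendrian.mult, mul_swap_right, mul_swap_of_ne x h6 h2] at h3 h4 h5
  refine ⟨⟨h6, h1, fun i hi => ?_, fun i hi => ?_, fun i => ?_⟩, h7⟩
  · have e1 := h3 i
    have e2 := h4 i
    grind [mul_swap_left, mul_swap_right, mul_swap_of_ne, not_strictlyBetween_left,
      not_strictlyBetween_right, Equiv.apply_eq_iff_eq]
  · have e1 := h3 i
    have e2 := h4 i
    grind [mul_swap_left, mul_swap_right, mul_swap_of_ne, not_strictlyBetween_left,
      not_strictlyBetween_right, Equiv.apply_eq_iff_eq]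
  · rw [← h5, GridLegendrian.mult, GridLegendrian.mult, mul_swap_right,
      mul_swap_of_ne x h2.symm h1.symm,
      h0.strip_add, h7.strip_add]
    ring

theorem IsPair.cut_upper_right_symm (h : IsPair X x k c a a b)
    (h0 : StrictlyBetween (x c) (x b) (x a)) :
    IsPair X x k a b c b ∧ StrictlyBetween c b a := by
  obtain ⟨h1, h2, h3, h4, h5⟩ := h
  have h6 : c ≠ b := fun h => not_strictlyBetween_self (h ▸ h0)
  have h7 : StrictlyBetween c b a :=
    (strictlyBetween_or h1 h6 h2).resolve_left fun h => h4 c ⟨h.rotate.rotate, by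
      rw [mul_swap_left, mul_swap_right, mul_swap_of_ne x h6.symm h2.symm]
      exact h0⟩
  have s1 := StrictlyBetween.split h7
  have s2 := StrictlyBetween.split h0
  simp only [Emp, GridLegendrian.mult, mul_swap_right, mul_swap_of_ne x h6.symm h2.symm] at h3 h4 h5
  refine ⟨⟨h2, h6, fun i hi => ?_, fun i hi => ?_, fun i => ?_⟩, h7⟩
  · have e1 := h3 i
    have e2 := h4 i
    grind [mul_swap_left, mul_swap_right, mul_swap_of_ne, not_strictlyBetween_left,
      not_strictlyBetween_right, Equiv.apply_eq_iff_eq]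
  · have e1 := h3 i
    have e2 := h4 i
    grind [mul_swap_left, mul_swap_right, mul_swap_of_ne, not_strictlyBetween_left,
      not_strictlyBetween_right, Equiv.apply_eq_iff_eq]
  · rw [← h5, GridLegendrian.mult, GridLegendrian.mult, mul_swap_right, mul_swap_of_ne x h1 h6,
      h7.strip_add, h0.strip_add]
    ring

end Pairs

/-! ### Annuli and the involution on pairs of empty rectangles -/

section Flip

variable {n : ℕ}

theorem strip_finRotate {k : Fin n} (hk : k ≠ finRotate n k) (i : Fin n) :
    strip k (finRotate n k) i = if i = k then 1 else 0 := by
  obtain _ | m := n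
  · exact k.elim0
  rw [finRotate_apply] at *
  by_cases h : k = Fin.last m
  · have h0 : k + 1 = 0 := by rw [h, Fin.last_add_one]
    rw [h0] at hk ⊢
    have := i.2
    have h1 : (k : ℕ) = m := by rw [h]; rfl
    simp only [strip, inStrip_iff, Fin.ext_iff, ne_eq, Fin.val_zero] at *
    congr 1
    simp only [eq_iff_iff]
    omega
  · have h0 : ((k + 1 : Fin (m + 1)) : ℕ) = k + 1 := by rw [Fin.val_add_one, if_neg h]
    simp only [strip, inStrip_iff, h0, Fin.ext_iff]
    congr 1
    simp only [eq_iff_iff]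
    omega

/-- The first strip of an arc begins at its left end, the last one ends at its right end, and both
must be strip `k`. -/
theorem eq_of_strip_eq {p q k : Fin n} (h : p ≠ q)
    (hs : ∀ i, strip p q i = if i = k then 1 else 0) : p = k ∧ q = finRotate n k := by
  have key : ∀ i, InStrip p q i → i = k := fun i hi => by
    by_contra hk
    have := hs i
    rw [strip_of hi, if_neg hk] at this
    exact one_ne_zero this
  obtain ⟨c, rfl⟩ := (finRotate n).surjective q
  exact ⟨key _ (KnotGrid.inStrip_self h), by rw [key _ (KnotGrid.inStrip_finRotate h)]⟩

theorem not_strictlyBetween_finRotate {k i : Fin n} (hk : k ≠ finRotate n k) :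
    ¬ StrictlyBetween k (finRotate n k) i := fun h => by
  have := strip_finRotate hk i
  rw [strip_of h.2, if_neg h.1] at this
  exact one_ne_zero this

variable {X x : GridState n} {k a b c d : Fin n}

/-- The two rectangles have the same columns and complementary rows, so they fill a vertical
annulus; every column carries a marking, hence only column `k` is covered. -/
theorem IsPair.eq_of_vertical (h : IsPair X x k a b a b) : a = k ∧ b = finRotate n k := by
  refine eq_of_strip_eq h.ne₁ fun i => ?_
  rw [← h.mult i, GridLegendrian.mult, GridLegendrian.mult, mul_swap_left, mul_swap_right,
    ← mul_add, strip_add_swap (x.injective.ne h.ne₁), mul_one]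

theorem IsPair.eq_of_horizontal (h : IsPair X x k a b b a) :
    x a = X k ∧ x b = finRotate n (X k) := by
  refine eq_of_strip_eq (x.injective.ne h.ne₁) fun j => ?_
  obtain ⟨i, rfl⟩ := X.surjective j
  simp only [X.apply_eq_iff_eq]
  rw [← h.mult i, GridLegendrian.mult, GridLegendrian.mult, mul_swap_left,
    mul_swap_right, ← add_mul, strip_add_swap h.ne₁, one_mul]

/-- A rectangle of width one has no circle strictly inside, so both halves of the annulus are empty.
-/
theorem isPair_vertical (hk : k ≠ finRotate n k) :
    IsPair X x k k (finRotate n k) k (finRotate n k) := by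
  refine ⟨hk, hk, fun i hi => not_strictlyBetween_finRotate hk hi.1,
    fun i hi => not_strictlyBetween_finRotate hk hi.1, fun i => ?_⟩
  rw [mult, mult, mul_swap_left, mul_swap_right,
    ← mul_add, strip_add_swap (x.injective.ne hk), mul_one, strip_finRotate hk]

theorem isPair_horizontal (hk : X k ≠ finRotate n (X k)) (ha : x a = X k)
    (hb : x b = finRotate n (X k)) : IsPair X x k a b b a := by
  have h : a ≠ b := fun h => hk (by rw [← hb, ← ha, h])
  refine ⟨h, h.symm, fun i hi => ?_, fun i hi => ?_, fun i => ?_⟩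
  · rw [ha, hb] at hi
    exact not_strictlyBetween_finRotate hk hi.2
  · rw [mul_swap_left, mul_swap_right, ha, hb] at hi
    exact not_strictlyBetween_finRotate hk hi.2
  · rw [mult, mult, mul_swap_left, mul_swap_right, ← add_mul, strip_add_swap h, one_mul, ha, hb,
      strip_finRotate hk]
    simp

open Classical in
/-- The involution of the pairs of empty rectangles that preserves the union of the two. -/
def flip (X x : GridState n) (k : Fin n) :
    Fin n × Fin n × Fin n × Fin n → Fin n × Fin n × Fin n × Fin n := fun (a, b, c, d) =>
  if a = c ∧ b = d then
    (x.symm (X k), x.symm (finRotate n (X k)), x.symm (finRotate n (X k)), x.symm (X k))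
  else if a = d ∧ b = c then (k, finRotate n k, k, finRotate n k)
  else if a = c then if StrictlyBetween a b d then (a, d, d, b) else (b, d, a, b)
  else if b = d then if StrictlyBetween a b c then (c, b, a, c) else (c, a, a, b)
  else if b = c then if StrictlyBetween (x a) (x b) (x d) then (a, d, a, b) else (b, d, a, d)
  else if a = d then if StrictlyBetween (x a) (x b) (x c) then (c, b, a, b) else (c, a, c, b)
  else (c, d, a, b)

theorem flip_inner_left (h1 : a ≠ d) (h2 : b ≠ d) (h : StrictlyBetween a b d) :
    flip X x k (a, b, a, d) = (a, d, d, b) := by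
  grind [flip]

theorem flip_outer_left (h1 : a ≠ d) (h2 : b ≠ d) (h : StrictlyBetween a d b) :
    flip X x k (a, b, a, d) = (b, d, a, b) := by
  have h0 := h.asymm
  grind [flip]

theorem flip_inner_right (ab : a ≠ b) (h1 : a ≠ c) (h : StrictlyBetween a b c) :
    flip X x k (a, b, c, b) = (c, b, a, c) := by
  grind [flip]

theorem flip_outer_right (ab : a ≠ b) (h1 : a ≠ c) (h : StrictlyBetween c b a) :
    flip X x k (a, b, c, b) = (c, a, a, b) := by
  have h0 : ¬ StrictlyBetween a b c := fun h' => h.asymm h'.rotate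
  grind [flip]

theorem flip_inner_lower (ab : a ≠ b) (h1 : a ≠ d) (h2 : b ≠ d)
    (h : StrictlyBetween (x a) (x b) (x d)) :
    flip X x k (a, b, b, d) = (a, d, a, b) := by
  grind [flip]

theorem flip_outer_lower (ab : a ≠ b) (h1 : a ≠ d) (h2 : b ≠ d)
    (h : StrictlyBetween (x a) (x d) (x b)) :
    flip X x k (a, b, b, d) = (b, d, a, d) := by
  have h0 := h.asymm
  grind [flip]

theorem flip_inner_upper (ab : a ≠ b) (h1 : a ≠ c) (h2 : b ≠ c)
    (h : StrictlyBetween (x a) (x b) (x c)) :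
    flip X x k (a, b, c, a) = (c, b, a, b) := by
  grind [flip]

theorem flip_outer_upper (ab : a ≠ b) (h1 : a ≠ c) (h2 : b ≠ c)
    (h : StrictlyBetween (x c) (x b) (x a)) :
    flip X x k (a, b, c, a) = (c, a, c, b) := by
  have h0 : ¬ StrictlyBetween (x a) (x b) (x c) := fun h' => h.asymm h'.rotate
  grind [flip]

/-- The move preserves the final state and has no fixed points, so the terms it pairs cancel modulo
2. The cases follow the vertical circles that the two rectangles share. -/
theorem flip_spec (hk : ∀ i, i ≠ finRotate n i) (h : IsPair X x k a b c d) :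
    (∃ a' b' c' d', flip X x k (a, b, c, d) = (a', b', c', d') ∧ IsPair X x k a' b' c' d' ∧
      x * Equiv.swap a' b' * Equiv.swap c' d' = x * Equiv.swap a b * Equiv.swap c d) ∧
    flip X x k (a, b, c, d) ≠ (a, b, c, d) ∧
    flip X x k (flip X x k (a, b, c, d)) = (a, b, c, d) := by
  have ab := h.ne₁
  have cd := h.ne₂
  -- A vertical annulus is exchanged with the horizontal annulus through the same marking; both
  -- compositions return to `x`.
  by_cases h1 : a = c ∧ b = d
  · obtain ⟨rfl, rfl⟩ := h1
    obtain ⟨rfl, rfl⟩ := h.eq_of_vertical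
    have e : x.symm (X a) ≠ x.symm (finRotate n (X a)) := x.symm.injective.ne (hk _)
    have e1 : flip X x a (a, finRotate n a, a, finRotate n a) = _ := if_pos ⟨rfl, rfl⟩
    refine ⟨⟨_, _, _, _, e1, isPair_horizontal (hk _) (by simp) (by simp), ?_⟩, ?_, ?_⟩
    · rw [Equiv.swap_comm (x.symm (finRotate n (X a))), mul_assoc, mul_assoc, Equiv.swap_mul_self,
        Equiv.swap_mul_self]
    · rw [e1]
      intro h
      simp only [Prod.mk.injEq] at h
      grind
    · rw [e1, flip, if_neg (fun h => e h.1), if_pos ⟨rfl, rfl⟩]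
  by_cases h2 : a = d ∧ b = c
  · obtain ⟨rfl, rfl⟩ := h2
    obtain ⟨ha, hb⟩ := h.eq_of_horizontal
    have e1 : flip X x k (a, b, b, a) = (k, finRotate n k, k, finRotate n k) := by
      rw [flip, if_neg h1, if_pos ⟨rfl, rfl⟩]
    refine ⟨⟨_, _, _, _, e1, isPair_vertical (hk _), ?_⟩, ?_, ?_⟩
    · rw [Equiv.swap_comm b a, mul_assoc, mul_assoc, Equiv.swap_mul_self,
        Equiv.swap_mul_self]
    · rw [e1]
      intro h
      simp only [Prod.mk.injEq] at h
      grind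
    · rw [e1, flip, if_pos ⟨rfl, rfl⟩, ← hb, ← ha]
      simp
  -- From here to the last case exactly one circle is shared and the union is L-shaped. The order of
  -- the columns (for `a = c` or `b = d`) or of the rows (for `b = c` or `a = d`) tells which corner
  -- is reflex.
  by_cases h3 : a = c
  · subst h3
    have bd : b ≠ d := fun h => h1 ⟨rfl, h⟩
    rcases strictlyBetween_or ab cd bd with h4 | h4
    · obtain ⟨hp, hs⟩ := h.cut_lower_left h4
      have e1 := flip_inner_left (X := X) (x := x) (k := k) cd bd h4
      refine ⟨⟨_, _, _, _, e1, hp, ?_⟩, ?_, ?_⟩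
      · rw [mul_assoc, mul_assoc]
        congr 1
        ext i
        simp only [Equiv.Perm.mul_apply, Equiv.swap_apply_def]
        grind
      · rw [e1]
        simp only [ne_eq, Prod.mk.injEq]
        grind
      · rw [e1]
        exact flip_inner_lower cd ab bd.symm hs
    · obtain ⟨hp, hs⟩ := h.cut_upper_left h4
      have e1 := flip_outer_left (X := X) (x := x) (k := k) cd bd h4
      refine ⟨⟨_, _, _, _, e1, hp, ?_⟩, ?_, ?_⟩
      · rw [mul_assoc, mul_assoc]
        congr 1
        ext i
        simp only [Equiv.Perm.mul_apply, Equiv.swap_apply_def]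
        grind
      · rw [e1]
        simp only [ne_eq, Prod.mk.injEq]
        grind
      · rw [e1]
        exact flip_outer_upper bd ab.symm cd.symm hs
  by_cases h4 : b = d
  · subst h4
    rcases strictlyBetween_or ab h3 cd.symm with h4 | h4
    · obtain ⟨hp, hs⟩ := h.cut_lower_right h4
      have e1 := flip_inner_right (X := X) (x := x) (k := k) ab h3 h4
      refine ⟨⟨_, _, _, _, e1, hp, ?_⟩, ?_, ?_⟩
      · rw [mul_assoc, mul_assoc]
        congr 1
        ext i
        simp only [Equiv.Perm.mul_apply, Equiv.swap_apply_def]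
        grind
      · rw [e1]
        simp only [ne_eq, Prod.mk.injEq]
        grind
      · rw [e1]
        exact flip_inner_upper cd (Ne.symm h3) ab.symm hs
    · obtain ⟨hp, hs⟩ := h.cut_upper_right h4.rotate.rotate
      have e1 := flip_outer_right (X := X) (x := x) (k := k) ab h3 h4.rotate.rotate
      refine ⟨⟨_, _, _, _, e1, hp, ?_⟩, ?_, ?_⟩
      · rw [mul_assoc, mul_assoc]
        congr 1
        ext i
        simp only [Equiv.Perm.mul_apply, Equiv.swap_apply_def]
        grind
      · rw [e1]
        simp only [ne_eq, Prod.mk.injEq]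
        grind
      · rw [e1]
        exact flip_outer_lower (Ne.symm h3) cd ab hs
  by_cases h5 : b = c
  · subst h5
    have ad : a ≠ d := fun h => h2 ⟨h, rfl⟩
    rcases strictlyBetween_or (x.injective.ne ab) (x.injective.ne ad)
      (x.injective.ne cd) with h4 | h4
    · obtain ⟨hp, hs⟩ := h.cut_lower_left_symm h4
      have e1 := flip_inner_lower (X := X) (x := x) (k := k) ab ad cd h4
      refine ⟨⟨_, _, _, _, e1, hp, ?_⟩, ?_, ?_⟩
      · rw [mul_assoc, mul_assoc]
        congr 1
        ext i
        simp only [Equiv.Perm.mul_apply, Equiv.swap_apply_def]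
        grind
      · rw [e1]
        simp only [ne_eq, Prod.mk.injEq]
        grind
      · rw [e1]
        exact flip_inner_left ab cd.symm hs
    · obtain ⟨hp, hs⟩ := h.cut_upper_right_symm h4
      have e1 := flip_outer_lower (X := X) (x := x) (k := k) ab ad cd h4
      refine ⟨⟨_, _, _, _, e1, hp, ?_⟩, ?_, ?_⟩
      · rw [mul_assoc, mul_assoc]
        congr 1
        ext i
        simp only [Equiv.Perm.mul_apply, Equiv.swap_apply_def]
        grind
      · rw [e1]
        simp only [ne_eq, Prod.mk.injEq]
        grind
      · rw [e1]
        exact flip_outer_right cd ab.symm hs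
  by_cases h6 : a = d
  · subst h6
    rcases strictlyBetween_or (x.injective.ne ab) (x.injective.ne h3)
      (x.injective.ne h5) with h4 | h4
    · obtain ⟨hp, hs⟩ := h.cut_lower_right_symm h4
      have e1 := flip_inner_upper (X := X) (x := x) (k := k) ab h3 h5 h4
      refine ⟨⟨_, _, _, _, e1, hp, ?_⟩, ?_, ?_⟩
      · rw [mul_assoc, mul_assoc]
        congr 1
        ext i
        simp only [Equiv.Perm.mul_apply, Equiv.swap_apply_def]
        grind
      · rw [e1]
        simp only [ne_eq, Prod.mk.injEq]
        grind
      · rw [e1]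
        exact flip_inner_right (Ne.symm h5) cd hs
    · obtain ⟨hp, hs⟩ := h.cut_upper_left_symm h4.rotate.rotate
      have e1 := flip_outer_upper (X := X) (x := x) (k := k) ab h3 h5 h4.rotate.rotate
      refine ⟨⟨_, _, _, _, e1, hp, ?_⟩, ?_, ?_⟩
      · rw [mul_assoc, mul_assoc]
        congr 1
        ext i
        simp only [Equiv.Perm.mul_apply, Equiv.swap_apply_def]
        grind
      · rw [e1]
        simp only [ne_eq, Prod.mk.injEq]
        grind
      · rw [e1]
        exact flip_outer_left (Ne.symm h5) ab hs
  -- No shared circle: the rectangles are taken in the other order.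
  have e1 : flip X x k (a, b, c, d) = (c, d, a, b) := by simp [flip, h3, h4, h5, h6]
  refine ⟨⟨_, _, _, _, e1,
    h.swap_of_disjoint (Ne.symm h3) (Ne.symm h5) (Ne.symm h6) (Ne.symm h4), ?_⟩,
    ?_, ?_⟩
  · rw [mul_assoc, mul_assoc]
    congr 1
    ext i
    simp only [Equiv.Perm.mul_apply, Equiv.swap_apply_def]
    grind
  · rw [e1]
    simp only [ne_eq, Prod.mk.injEq]
    grind
  · rw [e1]
    simp [flip, Ne.symm h3, Ne.symm h4, Ne.symm h5, Ne.symm h6]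

end Flip

/-! ### Commuting operators on cochains modulo 2 -/

section Cochain

variable {n : ℕ}

theorem mult_eq_zero_or_one (x : GridState n) (a b i j : Fin n) :
    mult x a b i j = 0 ∨ mult x a b i j = 1 := by
  unfold mult strip
  split_ifs <;> simp

/-- `a` and `b` bound an empty rectangle from `x` whose multiplicities at the markings `X`
are given by `e`. -/
def IsEmptyWith (X : GridState n) (e : Fin n → ℤ) (x : GridState n) (a b : Fin n) : Prop :=
  a ≠ b ∧ Emp x a b ∧ ∀ i, mult x a b i (X i) = e i

open Classical in
/-- The map on cochains modulo two that is dual to the count of empty rectangles whose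
multiplicities at the markings `X` are given by `e`. -/
def dualMap (X : GridState n) (e : Fin n → ℤ) (φ : GridState n → ZMod 2) (x : GridState n) :
    ZMod 2 :=
  ∑ a, ∑ b, if IsEmptyWith X e x a b then φ (x * Equiv.swap a b) else 0

open Classical in
theorem sum_isPair (hn : ∀ i, i ≠ finRotate n i) (X x : GridState n) (k : Fin n)
    (φ : GridState n → ZMod 2) :
    ∑ p : Fin n × Fin n × Fin n × Fin n, (if IsPair X x k p.1 p.2.1 p.2.2.1 p.2.2.2 then
      φ (x * Equiv.swap p.1 p.2.1 * Equiv.swap p.2.2.1 p.2.2.2) else 0) = 0 := by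
  rw [← Finset.sum_filter]
  refine Finset.sum_involution (fun p _ => flip X x k p) ?_ ?_ ?_ ?_
  · rintro ⟨a, b, c, d⟩ h
    obtain ⟨⟨a', b', c', d', e1, -, e3⟩, -, -⟩ := flip_spec hn (Finset.mem_filter.1 h).2
    dsimp only
    rw [e1]
    dsimp only
    rw [e3]
    exact CharTwo.add_self_eq_zero _
  · rintro ⟨a, b, c, d⟩ h -
    exact (flip_spec hn (Finset.mem_filter.1 h).2).2.1
  · rintro ⟨a, b, c, d⟩ h
    obtain ⟨⟨a', b', c', d', e1, e2, -⟩, -, -⟩ := flip_spec hn (Finset.mem_filter.1 h).2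
    rw [e1]
    exact Finset.mem_filter.2 ⟨Finset.mem_univ _, e2⟩
  · rintro ⟨a, b, c, d⟩ h
    exact (flip_spec hn (Finset.mem_filter.1 h).2).2.2

/-- Each rectangle has multiplicity 0 or 1 at a marking, so a total of 1 means that exactly one of
the two contains it. -/
theorem isPair_iff (X x : GridState n) (k a b c d : Fin n) : IsPair X x k a b c d ↔
    (IsEmptyWith X 0 x a b ∧ IsEmptyWith X (Pi.single k 1) (x * Equiv.swap a b) c d) ∨
    (IsEmptyWith X (Pi.single k 1) x a b ∧ IsEmptyWith X 0 (x * Equiv.swap a b) c d) := by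
  constructor
  · rintro ⟨h1, h2, h3, h4, h5⟩
    have key : ∀ i, i ≠ k → mult x a b i (X i) = 0 ∧
        mult (x * Equiv.swap a b) c d i (X i) = 0 := fun i hi => by
      have := h5 i
      rw [if_neg hi] at this
      rcases mult_eq_zero_or_one x a b i (X i) with e1 | e1 <;>
      rcases mult_eq_zero_or_one (x * Equiv.swap a b) c d i (X i) with e2 | e2 <;> omega
    have hk := h5 k
    rw [if_pos rfl] at hk
    rcases mult_eq_zero_or_one x a b k (X k) with e1 | e1
    · refine .inl ⟨⟨h1, h3, fun i => ?_⟩, h2, h4, fun i => ?_⟩ <;>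
      by_cases hi : i = k
      · rw [hi, e1]; rfl
      · exact (key i hi).1
      · rw [hi, Pi.single_eq_same]; omega
      · rw [Pi.single_eq_of_ne hi, (key i hi).2]
    · refine .inr ⟨⟨h1, h3, fun i => ?_⟩, h2, h4, fun i => ?_⟩ <;>
      by_cases hi : i = k
      · rw [hi, Pi.single_eq_same, e1]
      · rw [Pi.single_eq_of_ne hi, (key i hi).1]
      · rw [hi, Pi.zero_apply]; omega
      · exact (key i hi).2
  · rintro (⟨⟨h1, h3, h5⟩, h2, h4, h6⟩ | ⟨⟨h1, h3, h5⟩, h2, h4, h6⟩) <;>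
    refine ⟨h1, h2, h3, h4, fun i => ?_⟩ <;> rw [h5, h6] <;> simp [Pi.single_apply]

/-- The sum of the two composites is the sum over all pairs, which the involution makes zero. -/
theorem dualMap_comm (hn : ∀ i, i ≠ finRotate n i) (X : GridState n) (k : Fin n)
    (φ : GridState n → ZMod 2) :
    dualMap X 0 (dualMap X (Pi.single k 1) φ) = dualMap X (Pi.single k 1) (dualMap X 0 φ) := by
  classical
  ext x
  rw [← sub_eq_zero, CharTwo.sub_eq_add, ← sum_isPair hn X x k φ]
  simp only [Fintype.sum_prod_type, dualMap, ← Finset.sum_add_distrib]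
  refine Finset.sum_congr rfl fun a _ => Finset.sum_congr rfl fun b _ => ?_
  simp only [isPair_iff]
  by_cases h0 : IsEmptyWith X 0 x a b
  · have h1 : ¬ IsEmptyWith X (Pi.single k 1) x a b := fun h1 => by
      have := (h0.2.2 k).symm.trans (h1.2.2 k)
      simp at this
    simp [h0, h1]
  · by_cases h1 : IsEmptyWith X (Pi.single k 1) x a b <;> simp [h0, h1]

/-- The state that consists of the upper left corners of the squares with a marking. -/
def upperLeft (X : GridState n) : GridState n := finRotate n * X

theorem upperLeft_apply (X : GridState n) (v : Fin n) : upperLeft X v = finRotate n (X v) := rfl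

/-- The upper left corner of a rectangle belongs to its target. Here the square just inside that
corner carries a marking. -/
theorem dualMap_single_upperLeft (X : GridState n) :
    dualMap X 0 (Pi.single (upperLeft X) 1) = 0 := by
  ext x
  refine Finset.sum_eq_zero fun a _ => Finset.sum_eq_zero fun b _ => ?_
  split_ifs with h
  · refine Pi.single_eq_of_ne (fun hx => ?_) _
    have h1 : x b = finRotate n (X a) := by
      rw [← upperLeft_apply, ← hx, mul_swap_left]
    have h2 := h.2.2 a
    rw [mult, strip_of (KnotGrid.inStrip_self h.1), h1, strip_of] at h2
    · exact one_ne_zero h2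
    · exact KnotGrid.inStrip_finRotate (h1 ▸ x.injective.ne h.1)
  · rfl

end Cochain

/-! ### Point counts and multiplicities of domains -/

section Count

variable {n : ℕ}

open Classical in
/-- The indicator function of the circles after `r`, up to `c`, in the cyclic order. -/
def after (r c v : Fin n) : ℤ :=
  if 0 < ((v - r : Fin n) : ℕ) ∧ ((v - r : Fin n) : ℕ) ≤ ((c - r : Fin n) : ℕ) then 1 else 0

/-- On the way from strip `r` to strip `c`, the indicator of the arc rises at circle `a` and falls
at circle `b`. -/
theorem strip_sub_strip (a b c r : Fin n) :
    strip a b c - strip a b r = after r c a - after r c b := by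
  have := a.2
  have := b.2
  have := c.2
  have := r.2
  simp only [strip, after, inStrip_iff, val_sub_eq]
  grind

/-- The number of points of `x` in the box after the point `(r, s)`, up to `(i, j)`. -/
def count (r s : Fin n) (x : GridState n) (i j : Fin n) : ℤ :=
  ∑ v, after r i v * after s j (x v)

/-- Exchanging two points changes the count by a product of a column factor and a row factor. Thus
the endpoints determine a domain up to its values in column `r` and row `s`. -/
theorem count_sub_count (r s : Fin n) (x : GridState n) {a b : Fin n} (h : a ≠ b) (i j : Fin n) :
    count r s x i j - count r s (x * Equiv.swap a b) i j =
      mult x a b i j - mult x a b r j - mult x a b i s + mult x a b r s := by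
  have e : count r s x i j - count r s (x * Equiv.swap a b) i j =
      (after r i a - after r i b) * (after s j (x a) - after s j (x b)) := by
    rw [count, count, ← Finset.sum_sub_distrib, Fintype.sum_eq_add a b h, mul_swap_left,
      mul_swap_right]
    · ring
    · rintro v ⟨ha, hb⟩
      rw [mul_swap_of_ne x ha hb, sub_self]
  rw [e, ← strip_sub_strip, ← strip_sub_strip]
  simp only [mult]
  ring

end Count

/-! ### The unique chain of rectangles to the upper left state -/

section Flow

variable {m : ℕ}

/-- Column `m - t`. -/
def colRev (m t : ℕ) : Fin (m + 1) := ⟨m - t, by omega⟩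

theorem colRev_succ_add_one {m t : ℕ} (ht : t + 1 ≤ m) : colRev m (t + 1) + 1 = colRev m t := by
  ext
  have h : (colRev m (t + 1) : ℕ) = m - (t + 1) := rfl
  have h' : (colRev m t : ℕ) = m - t := rfl
  rw [Fin.val_add_one_of_lt' (by omega)]
  omega

/-- The states of a path of rectangles of width one from `upperLeft X` back to the state that
consists of the upper right corners of the squares with a marking. -/
def leftPath (X : GridState (m + 1)) : ℕ → GridState (m + 1)
  | 0 => upperLeft X
  | t + 1 => leftPath X t * Equiv.swap (colRev m t) (colRev m t + 1)

/-- The cochains obtained from the indicator function of `upperLeft X` by means of the rectangles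
that contain the marking of column `m`, then of column `m - 1`, and so on. -/
def leftCochain (X : GridState (m + 1)) : ℕ → GridState (m + 1) → ZMod 2
  | 0 => Pi.single (upperLeft X) 1
  | t + 1 => dualMap X (Pi.single (colRev m t) 1) (leftCochain X t)

/-- The height `X 0 + 1` travels left from circle 0, one circle per step. Behind it the points are
upper right corners of marked squares, ahead of it still upper left ones. -/
theorem leftPath_apply (X : GridState (m + 1)) {t : ℕ} (ht : t ≤ m) (v : Fin (m + 1)) :
    leftPath X t (v + 1) =
      (if (v : ℕ) < m - t then X (v + 1) else if (v : ℕ) = m - t then X 0 else X v) + 1 := by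
  induction t generalizing v with
  | zero =>
    have := v.2
    rw [leftPath, upperLeft_apply, finRotate_apply]
    split_ifs with h1 h2
    · rfl
    · rw [show v = Fin.last m from Fin.ext h2, Fin.last_add_one]
    · omega
  | succ t ih =>
    have hK : (colRev m t : ℕ) = m - t := rfl
    have hP : (colRev m (t + 1) : ℕ) = m - (t + 1) := rfl
    set K : Fin (m + 1) := colRev m t
    set P : Fin (m + 1) := colRev m (t + 1)
    have hPK : P + 1 = K := colRev_succ_add_one ht
    rw [leftPath]
    by_cases h1 : v = P
    · rw [h1, hPK, mul_swap_left, ih (by omega), if_neg (by omega), if_pos (by omega),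
        if_neg (by omega), if_pos (by omega)]
    by_cases h2 : v = K
    · have h3 := ih (by omega) P
      rw [if_pos (by omega), hPK] at h3
      rw [h2, mul_swap_right, h3, if_neg (by omega), if_neg (by omega)]
    have h3 : (v : ℕ) ≠ m - (t + 1) := fun h => h1 (Fin.ext (h.trans hP.symm))
    have h4 : (v : ℕ) ≠ m - t := fun h => h2 (Fin.ext (h.trans hK.symm))
    rw [mul_swap_of_ne _ (fun h => h1 (add_right_cancel (h.trans hPK.symm)))
      (fun h => h2 (add_right_cancel h)), ih (by omega)]
    by_cases h5 : (v : ℕ) < m - t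
    · rw [if_pos h5, if_pos (by omega)]
    · rw [if_neg h5, if_neg h4, if_neg (by omega), if_neg (by omega)]

theorem strip_add_one_self (r h : Fin (m + 1)) : strip (r + 1) h r = 0 := by
  refine strip_of_not ?_
  have h1 : ((r - (r + 1) : Fin (m + 1)) : ℕ) = m := by
    rw [sub_add_cancel_left, Fin.coe_neg_one]
  rw [InStrip, h1]
  have := (h - (r + 1)).2
  omega

theorem strip_add_one_right {a c : Fin (m + 1)} (h : a ≠ c + 1) : strip a (c + 1) c = 1 :=
  strip_of (by
    have := KnotGrid.inStrip_finRotate (a := a) (c := c)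
    rw [finRotate_apply] at this
    exact this h)

theorem add_one_ne_self (hm : 0 < m) (i : Fin (m + 1)) : i ≠ i + 1 := fun h => by
  have : NeZero m := ⟨hm.ne'⟩
  exact one_ne_zero (left_eq_add.1 h)

theorem strip_add_one (hm : 0 < m) (k i : Fin (m + 1)) :
    strip k (k + 1) i = if i = k then 1 else 0 := by
  have := strip_finRotate (k := k)
  rw [finRotate_apply] at this
  exact this (add_one_ne_self hm k) i

/-- The step in column `K` contributes the rectangle of width one from circle `X 0 + 1` up to circle
`X K + 1`; it misses column 0 and row `X 0`, so the correction terms at the base square vanish. -/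
theorem count_leftPath (X : GridState (m + 1)) {t : ℕ} (ht : t ≤ m) (i j : Fin (m + 1)) :
    count 0 (X 0) (leftPath X t) i j - count 0 (X 0) (upperLeft X) i j =
      if m - t < i then strip (X 0 + 1) (X i + 1) j else 0 := by
  induction t with
  | zero =>
    have := i.2
    rw [leftPath, sub_self, if_neg (by omega)]
  | succ t ih =>
    have hm : 0 < m := by omega
    have hK : (colRev m t : ℕ) = m - t := rfl
    have hP : (colRev m (t + 1) : ℕ) = m - (t + 1) := rfl
    have e1 := leftPath_apply X ht (colRev m (t + 1))
    have e2 := leftPath_apply X ht (colRev m t)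
    have e3 : leftPath X t = leftPath X (t + 1) * Equiv.swap (colRev m t) (colRev m t + 1) := by
      rw [leftPath, mul_assoc, Equiv.swap_mul_self, mul_one]
    set K : Fin (m + 1) := colRev m t
    set P : Fin (m + 1) := colRev m (t + 1)
    have hPK : P + 1 = K := colRev_succ_add_one ht
    rw [hPK, if_neg (by omega), if_pos (by omega)] at e1
    rw [if_neg (by omega), if_neg (by omega)] at e2
    have e4 := count_sub_count 0 (X 0) (leftPath X (t + 1)) (add_one_ne_self hm K) i j
    rw [← e3] at e4
    have hK0 : (0 : Fin (m + 1)) ≠ K := fun h => by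
      rw [← h, Fin.val_zero] at hK
      omega
    simp only [mult, e1, e2, strip_add_one hm, strip_add_one_self, if_neg hK0] at e4
    have e5 := ih (by omega)
    by_cases hi : i = K
    · rw [if_neg (by omega)] at e5
      rw [if_pos (by omega)]
      rw [if_pos hi, ← hi] at e4
      linarith
    · have : (i : ℕ) ≠ m - t := fun h => hi (Fin.ext (h.trans hK.symm))
      rw [if_neg hi] at e4
      simp only [show (m - (t + 1) < i) ↔ (m - t < i) by omega]
      linarith

/-- `D` is a nonnegative domain from `w` to `upperLeft X`, with multiplicity `1` at the markings of
the columns after column `m - t` and multiplicity `0` at the other markings. -/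
structure IsDomain (X : GridState (m + 1)) (t : ℕ) (w : GridState (m + 1))
    (D : Fin (m + 1) → Fin (m + 1) → ℤ) : Prop where
  nonneg : ∀ i j, 0 ≤ D i j
  marking : ∀ i, D i (X i) = if m - t < i then 1 else 0
  count : ∀ i j, count 0 (X 0) w i j - count 0 (X 0) (upperLeft X) i j =
    D i j - D 0 j - D i (X 0) + D 0 (X 0)

theorem IsDomain.add_mult {X : GridState (m + 1)} {t : ℕ} (ht : t + 1 ≤ m) {w : GridState (m + 1)}
    {a b : Fin (m + 1)} {D : Fin (m + 1) → Fin (m + 1) → ℤ}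
    (hD : IsDomain X t (w * Equiv.swap a b) D)
    (h : IsEmptyWith X (Pi.single (colRev m t) 1) w a b) :
    IsDomain X (t + 1) w (fun i j => D i j + mult w a b i j) := by
  obtain ⟨d1, d2, d3⟩ := hD
  refine ⟨fun i j => ?_, fun i => ?_, fun i j => ?_⟩
  · exact add_nonneg (d1 i j) (mul_nonneg (strip_nonneg _ _ _) (strip_nonneg _ _ _))
  · have hK : (colRev m t : ℕ) = m - t := rfl
    rw [d2, h.2.2]
    by_cases hi : i = colRev m t
    · rw [hi, Pi.single_eq_same, if_neg (by omega), if_pos (by omega), zero_add]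
    · have : (i : ℕ) ≠ m - t := fun h => hi (Fin.ext (h.trans hK.symm))
      simp only [Pi.single_eq_of_ne hi, add_zero, show (m - (t + 1) < i) ↔ (m - t < i) by omega]
  · have := d3 i j
    have := count_sub_count 0 (X 0) w h.1 i j
    linarith

/-- A nonzero value needs at least one chain of rectangles; adding up their multiplicities gives
`D`. -/
theorem exists_isDomain (X : GridState (m + 1)) {t : ℕ} (ht : t ≤ m)
    {w : GridState (m + 1)} (hw : leftCochain X t w ≠ 0) : ∃ D, IsDomain X t w D := by
  induction t generalizing w with
  | zero =>
    refine ⟨0, fun _ _ => le_rfl, fun i => ?_, fun i j => ?_⟩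
    · have := i.2
      rw [if_neg (by omega)]
      rfl
    · have : w = upperLeft X := by
        by_contra h
        exact hw (Pi.single_eq_of_ne (M := fun _ => ZMod 2) h 1)
      simp [this]
  | succ t ih =>
    classical
    rw [leftCochain, dualMap] at hw
    obtain ⟨a, -, ha⟩ := Finset.exists_ne_zero_of_sum_ne_zero hw
    obtain ⟨b, -, hb⟩ := Finset.exists_ne_zero_of_sum_ne_zero ha
    obtain ⟨h1, h2⟩ := ite_ne_right_iff.1 hb
    obtain ⟨D, hD⟩ := ih (by omega) h2
    exact ⟨_, hD.add_mult ht h1⟩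

/-- The domains from a state of the path `leftPath X` have multiplicity zero in the columns that
the path has already left. -/
theorem IsDomain.eq_zero {X : GridState (m + 1)} {t : ℕ} (ht : t ≤ m)
    {D : Fin (m + 1) → Fin (m + 1) → ℤ} (hD : IsDomain X t (leftPath X t) D)
    {i : Fin (m + 1)} (hi : (i : ℕ) ≤ m - t) (j : Fin (m + 1)) : D i j = 0 := by
  obtain ⟨d1, d2, d3⟩ := hD
  have h00 : D 0 (X 0) = 0 := by
    rw [d2, if_neg (by simp)]
  -- At the square `(i, X i)` the count already equals the prescribed multiplicity, so the two
  -- nonnegative corrections add up to zero.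
  have key : ∀ i, D 0 (X i) = 0 ∧ D i (X 0) = 0 := fun i => by
    by_cases h0 : i = 0
    · rw [h0]
      exact ⟨h00, h00⟩
    have h1 := d3 i (X i)
    rw [count_leftPath X ht, d2, h00] at h1
    have h2 := d1 0 (X i)
    have h3 := d1 i (X 0)
    rw [strip_add_one_right fun h => h0 (X.injective (add_right_cancel h)).symm] at h1
    split_ifs at h1 <;> constructor <;> omega
  have h1 := d3 i j
  -- Every row has a marking, so all of column 0 vanishes.
  have h2 := (key (X.symm j)).1
  rw [X.apply_symm_apply] at h2
  rw [count_leftPath X ht, if_neg (by omega), h2, (key i).2, h00] at h1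
  omega

/-- Any continuation of the rectangle gives a domain to which `IsDomain.eq_zero` applies. This
bounds the rectangle on the left, and its prescribed markings bound it on the right. -/
theorem eq_of_isEmptyWith_leftPath (X : GridState (m + 1)) {t : ℕ} (ht : t + 1 ≤ m)
    {a b : Fin (m + 1)}
    (h : IsEmptyWith X (Pi.single (colRev m t) 1) (leftPath X (t + 1)) a b)
    (hw : leftCochain X t (leftPath X (t + 1) * Equiv.swap a b) ≠ 0) :
    a = colRev m t ∧ b = colRev m t + 1 := by
  have hm : 0 < m := by omega
  have hK : (colRev m t : ℕ) = m - t := rfl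
  obtain ⟨D, hD⟩ := exists_isDomain X (t := t) (by omega) hw
  have hcol : ∀ i, InStrip a b i → m - t ≤ (i : ℕ) := fun i hi => by
    by_contra hlt
    have h1 := (hD.add_mult ht h).eq_zero ht (i := i) (by omega) (leftPath X (t + 1) a)
    have h2 := hD.nonneg i (leftPath X (t + 1) a)
    rw [mult, strip_of hi,
      strip_of (KnotGrid.inStrip_self ((leftPath X (t + 1)).injective.ne h.1))] at h1
    omega
  have hin : InStrip a b (colRev m t) := by
    by_contra hn
    have := h.2.2 (colRev m t)
    rw [mult, strip_of_not hn, Pi.single_eq_same, zero_mul] at this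
    exact zero_ne_one this
  -- The rectangle avoids column 0, so it does not wrap around; it contains column `m - t` and
  -- nothing to the left of it.
  have ha : a = colRev m t := by
    have h1 := hcol a (KnotGrid.inStrip_self h.1)
    have h2 := hcol 0
    rw [inStrip_iff] at hin h2
    rw [Fin.val_zero] at h2
    ext
    omega
  refine ⟨ha, ?_⟩
  obtain ⟨c, rfl⟩ : ∃ c, b = c + 1 := ⟨b - 1, (sub_add_cancel b 1).symm⟩
  have hc : InStrip a (c + 1) c := by
    have := KnotGrid.inStrip_finRotate (a := a) (c := c)
    rw [finRotate_apply] at this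
    exact this h.1
  have h1 := hcol c hc
  by_contra hne
  have hcK : c ≠ colRev m t := fun h => hne (by rw [h])
  -- If the last column `c` were another one, the upper right corner of the rectangle would be that
  -- of the marked square of column `c`, giving a second marking inside.
  have h2 := leftPath_apply X ht c
  rw [if_neg (by omega), if_neg (by omega)] at h2
  have h3 := h.2.2 c
  rw [Pi.single_eq_of_ne hcK, mult, strip_of hc, h2, strip_add_one_right, one_mul] at h3
  · exact one_ne_zero h3
  · rw [← h2]
    exact (leftPath X (t + 1)).injective.ne h.1

theorem leftCochain_leftPath (X : GridState (m + 1)) {t : ℕ} (ht : t ≤ m) :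
    leftCochain X t (leftPath X t) = 1 := by
  induction t with
  | zero => exact Pi.single_eq_same (M := fun _ => ZMod 2) _ _
  | succ t ih =>
    classical
    have hm : 0 < m := by omega
    have hK : (colRev m t : ℕ) = m - t := rfl
    have e1 := leftPath_apply X ht (colRev m (t + 1))
    have e2 := leftPath_apply X ht (colRev m t)
    have e3 : leftPath X t = leftPath X (t + 1) * Equiv.swap (colRev m t) (colRev m t + 1) := by
      rw [leftPath, mul_assoc, Equiv.swap_mul_self, mul_one]
    have hP : (colRev m (t + 1) : ℕ) = m - (t + 1) := rfl
    rw [colRev_succ_add_one ht, if_neg (by omega), if_pos hP] at e1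
    rw [if_neg (by omega), if_neg (by omega)] at e2
    have hs : IsEmptyWith X (Pi.single (colRev m t) 1) (leftPath X (t + 1)) (colRev m t)
        (colRev m t + 1) := by
      refine ⟨add_one_ne_self hm _, fun i hi => ?_, fun i => ?_⟩
      · have := not_strictlyBetween_finRotate (k := colRev m t) (i := i)
        rw [finRotate_apply] at this
        exact this (add_one_ne_self hm _) hi.1
      -- The width is one, and the top edge lies just above the marking of this column, so this is
      -- the only marking inside.
      · rw [mult, e1, e2, strip_add_one hm]
        split_ifs with hi
        · rw [hi, Pi.single_eq_same, strip_add_one_right, one_mul]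
          intro h
          have := congrArg Fin.val (X.injective (add_right_cancel h))
          rw [Fin.val_zero] at this
          omega
        · rw [zero_mul, Pi.single_eq_of_ne hi]
    rw [leftCochain, dualMap, Finset.sum_eq_single (colRev m t),
      Finset.sum_eq_single (colRev m t + 1), if_pos hs, ← e3, ih (by omega)]
    · intro b _ hb
      by_contra hne
      obtain ⟨h1, h2⟩ := ite_ne_right_iff.1 hne
      exact hb (eq_of_isEmptyWith_leftPath X ht h1 h2).2
    · exact fun h => absurd (Finset.mem_univ _) h
    · intro a _ ha
      refine Finset.sum_eq_zero fun b _ => ?_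
      by_contra hne
      obtain ⟨h1, h2⟩ := ite_ne_right_iff.1 hne
      exact ha (eq_of_isEmptyWith_leftPath X ht h1 h2).1
    · exact fun h => absurd (Finset.mem_univ _) h

theorem dualMap_leftCochain (hm : 0 < m) (X : GridState (m + 1)) (t : ℕ) :
    dualMap X 0 (leftCochain X t) = 0 := by
  induction t with
  | zero => exact dualMap_single_upperLeft X
  | succ t ih =>
    have hn : ∀ i, i ≠ finRotate (m + 1) i := fun i => by
      rw [finRotate_apply]
      exact add_one_ne_self hm i
    rw [leftCochain, dualMap_comm hn, ih]
    ext x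
    simp [dualMap]

end Flow

/-! ### Cocycles for the two corner states, and rotation by 180 degrees -/

section Cocycle

variable {m : ℕ}

theorem exists_cocycle_upperRight (hm : 0 < m) (X : GridState (m + 1)) :
    ∃ φ, dualMap X 0 φ = 0 ∧ φ (finRotate (m + 1) * X * (finRotate (m + 1))⁻¹) = 1 := by
  refine ⟨leftCochain X m, dualMap_leftCochain hm X m, ?_⟩
  rw [← leftCochain_leftPath X le_rfl]
  refine congrArg _ (Equiv.ext fun v => ?_)
  obtain ⟨c, rfl⟩ := (finRotate (m + 1)).surjective v
  rw [Equiv.Perm.mul_apply, Equiv.Perm.inv_def, Equiv.symm_apply_apply, finRotate_apply,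
    leftPath_apply X le_rfl, Equiv.Perm.mul_apply, finRotate_apply, if_neg (by omega)]
  split_ifs with h
  · rw [show c = 0 from Fin.ext (by simpa using h)]
  · rfl

/-- Circles go to their negatives; strip `i`, between circles `i` and `i + 1`, goes to the strip
that starts at `-(i + 1)`. -/
theorem inStrip_neg {a b i : Fin (m + 1)} : InStrip (-b) (-a) (-1 - i) ↔ InStrip a b i := by
  have h1 : -1 - i - -b = -1 - ((i - a) - (b - a)) := by abel
  have h2 : -a - -b = b - a := by abel
  have h3 : ∀ c : Fin (m + 1), ((-1 - c : Fin (m + 1)) : ℕ) = m - c := fun c => by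
    have := c.2
    rw [val_sub_eq, Fin.coe_neg_one, if_pos (by omega)]
  have := (i - a).2
  have := (b - a).2
  rw [InStrip, InStrip, h1, h2, h3, val_sub_eq]
  split_ifs <;> omega

theorem strictlyBetween_neg {a b i : Fin (m + 1)} :
    StrictlyBetween (-b) (-a) (-i) ↔ StrictlyBetween a b i := by
  have h : ∀ c : Fin (m + 1), ((-c : Fin (m + 1)) : ℕ) = if (c : ℕ) = 0 then 0 else m + 1 - c :=
    fun c => by
      rw [← zero_sub, val_sub_eq, Fin.val_zero]
      split_ifs <;> omega
  have := a.2
  have := b.2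
  have := i.2
  rw [strictlyBetween_iff, strictlyBetween_iff, h, h, h]
  split_ifs <;> omega

/-- The rotation of the torus by 180 degrees. -/
def rotateState (x : GridState (m + 1)) : GridState (m + 1) :=
  Equiv.neg _ * x * Equiv.neg _

/-- The action of the rotation of the torus by 180 degrees on the markings. -/
def rotateMarking (X : GridState (m + 1)) : GridState (m + 1) :=
  Equiv.subLeft (-1) * X * Equiv.subLeft (-1)

theorem rotateState_apply (x : GridState (m + 1)) (v : Fin (m + 1)) :
    rotateState x v = -x (-v) := rfl

theorem rotateMarking_apply (X : GridState (m + 1)) (v : Fin (m + 1)) :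
    rotateMarking X v = -1 - X (-1 - v) := rfl

theorem rotateState_mul_swap (x : GridState (m + 1)) (a b : Fin (m + 1)) :
    rotateState (x * Equiv.swap a b) = rotateState x * Equiv.swap (-b) (-a) := by
  ext v : 1
  rw [rotateState_apply, Equiv.Perm.mul_apply, Equiv.Perm.mul_apply, rotateState_apply,
    Equiv.swap_apply_def, Equiv.swap_apply_def]
  simp only [neg_eq_iff_eq_neg]
  split_ifs <;> simp_all

theorem mult_rotate (x : GridState (m + 1)) (a b i j : Fin (m + 1)) :
    mult (rotateState x) (-b) (-a) (-1 - i) (-1 - j) = mult x a b i j := by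
  classical
  simp only [mult, strip, rotateState_apply, inStrip_neg, neg_neg]

theorem isEmptyWith_rotate (X x : GridState (m + 1)) (a b : Fin (m + 1)) :
    IsEmptyWith (rotateMarking X) 0 (rotateState x) (-b) (-a) ↔ IsEmptyWith X 0 x a b := by
  refine and_congr ?_ (and_congr ?_ ?_)
  · rw [ne_eq, neg_inj, eq_comm]
  · rw [Emp, ← (Equiv.neg (Fin (m + 1))).forall_congr_right]
    simp only [Equiv.neg_apply, rotateState_apply, neg_neg, strictlyBetween_neg]
    rfl
  · rw [← (Equiv.subLeft (-1 : Fin (m + 1))).forall_congr_right]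
    simp only [Equiv.subLeft_apply, rotateMarking_apply, sub_sub_cancel, mult_rotate]
    rfl

/-- The rotation exchanges lower left and upper right corners and preserves empty rectangles without
markings, so the cocycle of the rotated diagram pulls back. -/
theorem exists_cocycle_lowerLeft (hm : 0 < m) (X : GridState (m + 1)) :
    ∃ φ, dualMap X 0 φ = 0 ∧ φ X = 1 := by
  obtain ⟨φ, h1, h2⟩ := exists_cocycle_upperRight hm (rotateMarking X)
  refine ⟨fun x => φ (rotateState x), funext fun x => ?_, ?_⟩
  · classical
    refine Eq.trans ?_ (congrFun h1 (rotateState x))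
    rw [dualMap, dualMap, Finset.sum_comm,
      ← Equiv.sum_comp (Equiv.neg (Fin (m + 1)))]
    refine Finset.sum_congr rfl fun b _ => ?_
    rw [← Equiv.sum_comp (Equiv.neg (Fin (m + 1)))]
    refine Finset.sum_congr rfl fun a _ => ?_
    simp only [Equiv.neg_apply]
    have h3 := isEmptyWith_rotate X x (-a) (-b)
    have h4 := rotateState_mul_swap x (-a) (-b)
    rw [neg_neg, neg_neg] at h3 h4
    simp only [← h3, h4]
  · rw [← h2]
    refine congrArg φ (Equiv.ext fun v => ?_)
    obtain ⟨c, rfl⟩ := (finRotate (m + 1)).surjective v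
    rw [Equiv.Perm.mul_apply, Equiv.Perm.inv_def, Equiv.symm_apply_apply, Equiv.Perm.mul_apply,
      finRotate_apply,
      finRotate_apply, rotateMarking_apply, rotateState_apply, neg_add_rev,
      ← sub_eq_add_neg]
    abel

end Cocycle

/-! ### From cocycles to classes that are not torsion -/

namespace KnotGrid

variable {n : ℕ}

theorem noX_iff (G : KnotGrid n) (x : GridState n) (r : Rect n) :
    G.NoX x r ↔ ∀ i, mult x r.1.1 r.1.2 i (G.X i) = 0 := by
  refine forall_congr' fun i => ?_
  simp only [Rect.HasSquare, mult, strip]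
  split_ifs <;> simp [*]

/-- The homomorphism to `ℤ / 2` that sends all indeterminates to `1`. -/
def evalOne (n : ℕ) : MvPolynomial (Fin n) ℤ →+* ZMod 2 :=
  MvPolynomial.eval₂Hom (Int.castRingHom (ZMod 2)) fun _ => 1

theorem unit_cast_zmod_two (s : ℤˣ) : ((s : ℤ) : ZMod 2) = 1 := by
  rcases Int.units_eq_one_or s with rfl | rfl
  · simp
  · decide

theorem smul_mk_ne_zero (G : KnotGrid n) (S : RectSign n) {φ : GridState n → ZMod 2}
    (hφ : dualMap G.X 0 φ = 0) {x : GridState n} (hx : φ x = 1)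
    (z : LinearMap.ker (G.gradedMap S (MvPolynomial.X (R := ℤ)))) (s : ℤˣ)
    (hz : (z : GridState n →₀ MvPolynomial (Fin n) ℤ) = (s : ℤ) • Finsupp.single x 1)
    (i : Fin n) (d : ℕ) :
    (MvPolynomial.X i : MvPolynomial (Fin n) ℤ) ^ d •
      (Submodule.Quotient.mk z : G.HFKMinus S) ≠ 0 := by
  classical
  -- With each `U_i` acting on `ZMod 2` as the identity, the functional `L` is linear over the
  -- polynomial ring.
  let _ : Module (MvPolynomial (Fin n) ℤ) (ZMod 2) := Module.compHom _ (evalOne n)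
  have hsmul : ∀ (p : MvPolynomial (Fin n) ℤ) (c : ZMod 2), p • c = evalOne n p * c :=
    fun _ _ => rfl
  set L := Finsupp.linearCombination (MvPolynomial (Fin n) ℤ) φ
  have hL : L ∘ₗ G.gradedMap S MvPolynomial.X = 0 := by
    ext y
    have h1 := congrFun hφ y
    rw [dualMap, ← Fintype.sum_prod_type', Pi.zero_apply] at h1
    simp only [gradedMap, gridMap, LinearMap.comp_apply, Finsupp.lsingle_apply,
      Finsupp.linearCombination_single, one_smul, map_sum, LinearMap.zero_comp,
      LinearMap.zero_apply, apply_ite L, map_zero, L, hsmul]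
    have h2 : ∀ p : Fin n × Fin n, IsEmptyWith G.X 0 y p.1 p.2 → p.1 ≠ p.2 := fun p h => h.1
    refine Eq.trans ?_ h1
    -- The cochain sum runs over all ordered pairs of circles; its diagonal terms vanish, which
    -- leaves the rectangles.
    rw [← Finset.sum_filter_of_ne (p := fun p : Fin n × Fin n => p.1 ≠ p.2)
      fun p _ hp => h2 p (ite_ne_right_iff.1 hp).1,
      Finset.sum_subtype (p := fun p : Fin n × Fin n => p.1 ≠ p.2) _ (by simp)]
    refine Finset.sum_congr rfl fun r _ => ?_
    have h3 : (r.IsEmptyRect y ∧ G.NoX y r) ↔ IsEmptyWith G.X 0 y r.1.1 r.1.2 := by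
      rw [noX_iff]
      exact ⟨fun h => ⟨r.2, h⟩, fun h => h.2⟩
    simp only [h3]
    refine if_congr Iff.rfl ?_ rfl
    rw [map_mul, map_intCast, unit_cast_zmod_two, one_mul, map_prod, Finset.prod_eq_one, one_mul]
    · rfl
    · intro j _
      split_ifs
      · simp [evalOne]
      · exact map_one _
  intro h
  rw [← Submodule.Quotient.mk_smul, Submodule.Quotient.mk_eq_zero] at h
  obtain ⟨c, hc⟩ := h
  have h1 := LinearMap.congr_fun hL c
  rw [LinearMap.comp_apply, hc] at h1
  simp only [LinearMap.zero_apply, Submodule.subtype_apply, hz, map_smul,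
    map_zsmul, L, Finsupp.linearCombination_single, hx, hsmul, one_mul, map_one, map_pow] at h1
  rw [zsmul_eq_mul, unit_cast_zmod_two, evalOne, MvPolynomial.coe_eval₂Hom,
    MvPolynomial.eval₂_X, one_pow] at h1
  exact absurd h1 (by decide)

/-- A cycle moves some column, so there are at least two; on a smaller torus the circles `i` and `i
+ 1` would coincide. -/
theorem exists_eq_succ (G : KnotGrid n) : ∃ m, 0 < m ∧ n = m + 1 := by
  obtain ⟨i, hi, -⟩ := G.isCycle
  have h : ((G.X⁻¹ * G.O) i : ℕ) ≠ i := fun h => hi (Fin.ext h)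
  have := i.2
  have := ((G.X⁻¹ * G.O) i).2
  exact ⟨n - 1, by omega, by omega⟩

theorem smul_lambdaPlus_ne_zero (G : KnotGrid n) (S : RectSign n) (i : Fin n) (d : ℕ) :
    (MvPolynomial.X i : MvPolynomial (Fin n) ℤ) ^ d • G.lambdaPlus S ≠ 0 := by
  obtain ⟨m, hm, rfl⟩ := G.exists_eq_succ
  obtain ⟨φ, h1, h2⟩ := exists_cocycle_upperRight hm G.X
  exact G.smul_mk_ne_zero S h1 (x := G.xUR) h2 (G.cycleUR S MvPolynomial.X) 1
    (by rw [Units.val_one, one_zsmul]; rfl) i d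

theorem smul_lambdaMinus_ne_zero (G : KnotGrid n) (S : RectSign n) (i : Fin n) (d : ℕ) :
    (MvPolynomial.X i : MvPolynomial (Fin n) ℤ) ^ d • G.lambdaMinus S ≠ 0 := by
  obtain ⟨m, hm, rfl⟩ := G.exists_eq_succ
  obtain ⟨φ, h1, h2⟩ := exists_cocycle_lowerLeft hm G.X
  exact G.smul_mk_ne_zero S h1 (x := G.xLL) h2 ((G.signLL S : ℤ) • G.cycleLL S MvPolynomial.X)
    (G.signLL S) rfl i d

theorem ne_zero_and_not_isUTorsion (G : KnotGrid n) (S : RectSign n) {η : G.HFKMinus S}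
    (h : ∀ (i : Fin n) (d : ℕ), (MvPolynomial.X i : MvPolynomial (Fin n) ℤ) ^ d • η ≠ 0) :
    η ≠ 0 ∧ ¬ G.IsUTorsion S η := by
  -- The exponent `d = 0` yields `η ≠ 0`, but only once some column exists.
  obtain ⟨i, -⟩ := G.isCycle
  exact ⟨by simpa using h i 0, fun ⟨j, d, _, hd⟩ => h j d hd⟩

end KnotGrid

end

end GridLegendrian

theorem theorem1p5 :
    (∀ (K : GridLegendrian.LegendrianKnot) (n : ℕ) (G : GridLegendrian.KnotGrid n)
      (S : GridLegendrian.RectSign n), G.Represents K → G.IsSignAssignment S →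
        (G.lambdaPlus S ≠ 0 ∧ ¬ G.IsUTorsion S (G.lambdaPlus S)) ∧
        (G.lambdaMinus S ≠ 0 ∧ ¬ G.IsUTorsion S (G.lambdaMinus S))) ∧
    (∀ (T : GridLegendrian.TransverseKnot) (K : GridLegendrian.LegendrianKnot) (n : ℕ)
      (G : GridLegendrian.KnotGrid n) (S : GridLegendrian.RectSign n),
        GridLegendrian.IsLegendrianApproximation K T → G.Represents K → G.IsSignAssignment S →
        G.theta S ≠ 0 ∧ ¬ G.IsUTorsion S (G.theta S)) := by
  have h1 {n : ℕ} (G : GridLegendrian.KnotGrid n) (S : GridLegendrian.RectSign n) :=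
    G.ne_zero_and_not_isUTorsion S (G.smul_lambdaPlus_ne_zero S)
  have h2 {n : ℕ} (G : GridLegendrian.KnotGrid n) (S : GridLegendrian.RectSign n) :=
    G.ne_zero_and_not_isUTorsion S (G.smul_lambdaMinus_ne_zero S)
  exact ⟨fun _ _ G S _ _ => ⟨h1 G S, h2 G S⟩, fun _ _ _ G S _ _ _ => h1 G S⟩
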